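/- Let $n\ge 2$. A ray in a space $X$ is a proper embedding $[0,\infty)\to X$. (a) Let $M$ be a contractible (topological) $n$-manifold, and let $A,B\subseteq M$ be subspaces with $A\cup B=M$ such that $A$, $B$ and $C=A\cap B$ are all homeomorphic to $\mathbb{R}^n$. Suppose that neither of $A$, $B$ is a proper subset of the other. Then there is a ray $r$ in $C$ which is also proper in both $A$ and $B$, that is, $r\colon[0,\infty)\to C$ is a proper embedding and its compositions with the inclusions $C\hookrightarrow A$ and $C\hookrightarrow B$ are proper. (b) Let $M$ be a compact contractible $n$-manifold with boundary, and let $A,B\subseteq M$ be subspaces with $A\cup B=M$ such that $A$, $B$ and $C=A\cap B$ are all homeomorphic to the closed unit ball $\mathbb{B}^n$. Suppose that neither of $A$, $B$ is a proper subset of the other. Then there is a ray $r$ in $\operatorname{int}C$ which is also proper in both $\operatorname{int}A$ and $\operatorname{int}B$, where $\operatorname{int}$ denotes the interior as a manifold with boundary. In both parts, if $M$ is a piecewise linear manifold, then $r$ can be chosen piecewise linear. -/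

import Mathlib

open scoped Manifold NNReal

universe u

/-- A ray in `X`: a proper embedding `[0, ∞) → X`. -/
def IsRay {X : Type*} [TopologicalSpace X] (r : ℝ≥0 → X) : Prop :=
  Topology.IsEmbedding r ∧ IsProperMap r

/-- `r` takes its values in the subspace `S` and is a ray (a proper embedding) in `S`. -/
def IsRayIn {M : Type*} [TopologicalSpace M] (r : ℝ≥0 → M) (S : Set M) : Prop :=
  ∃ h : ∀ t, r t ∈ S, IsRay (Set.codRestrict r S h)

/-- `M = A ∪_C B` with `A`, `B` and `C = A ∩ B` homeomorphic to `ℝⁿ`. -/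
structure IsOpenSplitting (n : ℕ) {M : Type*} [TopologicalSpace M] (A B C : Set M) : Prop where
  union_eq : A ∪ B = Set.univ
  inter_eq : A ∩ B = C
  homeo_A : Nonempty (A ≃ₜ EuclideanSpace ℝ (Fin n))
  homeo_B : Nonempty (B ≃ₜ EuclideanSpace ℝ (Fin n))
  homeo_C : Nonempty (C ≃ₜ EuclideanSpace ℝ (Fin n))

/-- `M = A ∪_C B` with `A`, `B` and `C = A ∩ B` homeomorphic to the closed unit ball of `ℝⁿ`. -/
structure IsClosedSplitting (n : ℕ) {M : Type*} [TopologicalSpace M] (A B C : Set M) : Prop where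
  union_eq : A ∪ B = Set.univ
  inter_eq : A ∩ B = C
  homeo_A : Nonempty (A ≃ₜ Metric.closedBall (0 : EuclideanSpace ℝ (Fin n)) 1)
  homeo_B : Nonempty (B ≃ₜ Metric.closedBall (0 : EuclideanSpace ℝ (Fin n)) 1)
  homeo_C : Nonempty (C ≃ₜ Metric.closedBall (0 : EuclideanSpace ℝ (Fin n)) 1)

/-- The interior of a subspace `X` that is an `n`-manifold with boundary: the points of `X` that
have a (relatively) open neighbourhood in `X` homeomorphic to `ℝⁿ`. -/
def manifoldInterior (n : ℕ) {M : Type*} [TopologicalSpace M] (X : Set M) : Set M :=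
  {x | ∃ O : Set M, IsOpen O ∧ x ∈ X ∩ O ∧ Nonempty (↥(X ∩ O) ≃ₜ EuclideanSpace ℝ (Fin n))}

/-- `f` is piecewise linear on `s`: every point of `s` has a neighbourhood in `s` that is a finite
union of convex polytopes on each of which `f` is affine. -/
def IsPLOn {E F : Type*} [NormedAddCommGroup E] [NormedSpace ℝ E]
    [NormedAddCommGroup F] [NormedSpace ℝ F] (f : E → F) (s : Set E) : Prop :=
  ∀ x ∈ s, ∃ K : Finset (Set E),
    (⋃ P ∈ K, P) ∈ nhdsWithin x s ∧
    ∀ P ∈ K, P ⊆ s ∧ (∃ V : Set E, V.Finite ∧ P = convexHull ℝ V) ∧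
      ∃ L : E →ᵃ[ℝ] F, Set.EqOn f L P

/-- `M`, with its given atlas, is a piecewise linear manifold (with boundary, if the model `I` has
one): all coordinate changes are piecewise linear. -/
def IsPLManifold {E H : Type*} [NormedAddCommGroup E] [NormedSpace ℝ E] [TopologicalSpace H]
    (I : ModelWithCorners ℝ E H) (M : Type*) [TopologicalSpace M] [ChartedSpace H M] : Prop :=
  ∀ e ∈ atlas H M, ∀ e' ∈ atlas H M,
    IsPLOn (e'.extend I ∘ (e.extend I).symm) ((e.extend I).symm.trans (e'.extend I)).source

/-- The curve `r` is piecewise linear: around every parameter `t` it is, in some chart of the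
atlas, affine on a short interval before `t` and affine on a short interval after `t`. -/
def IsPLCurve {E H : Type*} [NormedAddCommGroup E] [NormedSpace ℝ E] [TopologicalSpace H]
    (I : ModelWithCorners ℝ E H) {M : Type*} [TopologicalSpace M] [ChartedSpace H M]
    (r : ℝ≥0 → M) : Prop :=
  ∀ t : ℝ≥0, ∃ e ∈ atlas H M, ∃ ε > (0 : ℝ), ∃ v w : E, ∀ s : ℝ≥0, |(s : ℝ) - t| < ε →
    r s ∈ e.source ∧
    (s ≤ t → e.extend I (r s) = e.extend I (r t) + ((s : ℝ) - t) • v) ∧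
    (t ≤ s → e.extend I (r s) = e.extend I (r t) + ((s : ℝ) - t) • w)

/-!
Write `E = ℝⁿ`. Invariance of domain (`isOpen_image_of_continuousOn_injOn`) shows that in part (a)
the sets `A`, `B`, `C` are open in `M`. In part (b) it shows that the interiors of `A`, `B`, `C`
are open in `M`, are copies of `E`, and that `int C = int A ∩ int B`; so both parts reduce to
`exists_ray_in_inter`, about open cells `A`, `B` with intersection an open cell `C`, neither of the
two properly inside the other. Invariance of domain is deduced from a form of Brouwer's theorem,
and that from the absence of `C¹` retractions of a ball onto its boundary: along the segment from
the identity to a retraction, the integral of the Jacobian determinant is a polynomial in the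
parameter which is constant near `0` and vanishes at `1`.

A ray in `C` is proper in `C`, `A` and `B` as soon as it leaves every compact subset of `A` and of
`B`. If `A = B`, any straight ray of `C` will do. Otherwise `A \ C` and `B \ C` are nonempty
disjoint closed subsets of the normal space `A ∪ B`; let `φ` be a Urysohn function that is `0` on
the first and `1` on the second. On a set of the form `{x ∈ C | |φ x - 1/2| < 1/4}`, going to
infinity in `C` is the same as leaving the compact subsets of `A` and of `B`, because the closure
of this set in `A ∪ B` lies in `C`. A path in `A` from `C` to its first exit point gives an
unbounded connected subset of `C ≅ E` on which `φ < 1/2`, and likewise for `B` and `φ > 1/2`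
(`exists_unbounded_isPreconnected`). The level set `φ = 1/2` separates these two sets, and it must
go to infinity: if a compact part of it could be split off around a large ball, there would be a
function to `ℝ² \ {0}` on the simply connected space `E` with winding number one
(`false_of_winding`). A limit argument along an ultrafilter turns this into a chain of points,
consecutive ones being joined by paths that escape to infinity near the level set
(`exists_joinedIn_sequence`, `exists_escaping_chain`).

Finally the paths are replaced by chains of straight segments in charts, and the resulting infinite
polygon is made injective by loop erasure (`exists_loop_erasure`), which keeps the curve inside the
segments already chosen. The curve is affine in a chart before and after every parameter; on a
piecewise linear manifold the two charts can be taken to be the same (`IsPLManifold.isPLCurve`).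
-/

/-! ### Nonexistence of a retraction of the ball onto the sphere -/

section Brouwer

open MeasureTheory Metric Set Polynomial

variable {E : Type*} [NormedAddCommGroup E] [InnerProductSpace ℝ E] [FiniteDimensional ℝ E]

theorem continuous_coeff_finset_prod {X ι : Type*} [TopologicalSpace X] (s : Finset ι)
    (p : ι → X → ℝ[X]) (hp : ∀ i k, Continuous fun x => (p i x).coeff k) (k : ℕ) :
    Continuous fun x => (∏ i ∈ s, p i x).coeff k := by
  classical
  induction s using Finset.induction_on generalizing k with
  | empty => simpa using continuous_const
  | insert a s ha ih =>
    simp only [Finset.prod_insert ha, coeff_mul]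
    exact continuous_finsetSum _ fun q _ => (hp a q.1).mul (ih q.2)

/-- `det (1 + t A(x))` is a polynomial in `t` whose coefficients depend continuously on `x`. -/
theorem exists_det_one_add_smul_eq_sum {T : Type*} [TopologicalSpace T] {A : T → E →L[ℝ] E}
    (hA : Continuous A) :
    ∃ (N : ℕ) (c : ℕ → T → ℝ), (∀ k, Continuous (c k)) ∧
      ∀ t x, (1 + t • A x).det = ∑ k ∈ Finset.range N, c k x * t ^ k := by
  classical
  set b := Module.finBasis ℝ E
  let m : T → Matrix _ _ ℝ := fun x => LinearMap.toMatrix b b (A x : E →ₗ[ℝ] E)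
  let p : T → ℝ[X] := fun x =>
    Matrix.det ((X : ℝ[X]) • (m x).map C + (1 : Matrix (Fin (Module.finrank ℝ E))
        (Fin (Module.finrank ℝ E)) ℝ).map C)
  have hm : ∀ i j, Continuous fun x => m x i j := by
    intro i j
    have : (fun x => m x i j) = fun x => b.coord i (A x (b j)) := by
      ext x; simp [m, LinearMap.toMatrix_apply]
    rw [this]
    exact (LinearMap.continuous_of_finiteDimensional (b.coord i)).comp
        (hA.clm_apply continuous_const)
  refine ⟨Module.finrank ℝ E + 1, fun k x => (p x).coeff k, fun k => ?_, fun t x => ?_⟩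
  · simp only [p, Matrix.det_apply, finsetSum_coeff]
    refine continuous_finsetSum _ fun σ _ => ?_
    have hq := continuous_coeff_finset_prod Finset.univ
      (fun i x => C (m x (σ i) i) * (X : ℝ[X]) +
        C ((1 : Matrix (Fin (Module.finrank ℝ E)) (Fin (Module.finrank ℝ E)) ℝ) (σ i) i)) ?_ k
    · have he : ∀ i x, ((X : ℝ[X]) • (m x).map C +
          (1 : Matrix (Fin (Module.finrank ℝ E)) (Fin (Module.finrank ℝ E)) ℝ).map C) (σ i) i =
          C (m x (σ i) i) * (X : ℝ[X]) +
        C ((1 : Matrix (Fin (Module.finrank ℝ E)) (Fin (Module.finrank ℝ E)) ℝ) (σ i) i) := by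
        intro i x
        rw [Matrix.add_apply, Matrix.smul_apply, Matrix.map_apply, Matrix.map_apply, smul_eq_mul,
          mul_comm]
      simp only [he]
      rcases Int.units_eq_one_or (Equiv.Perm.sign σ) with h | h
      · simpa only [h, one_smul] using hq
      · simpa only [h, neg_smul, one_smul, Units.neg_smul, coeff_neg, ← Pi.neg_def] using hq.neg
    · intro i k
      simp only [coeff_add, coeff_C_mul, coeff_C]
      exact ((hm _ _).mul continuous_const).add continuous_const
  · have h1 : (1 + t • A x).det = (1 + t • m x).det := by
      rw [ContinuousLinearMap.det, ← LinearMap.det_toMatrix b]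
      congr 1
      simp [m, LinearMap.toMatrix_one]
    have h2 : (1 + t • m x).det = (p x).eval t := by
      simp only [p]
      rw [← coe_evalRingHom, RingHom.map_det]
      congr 1
      ext i j
      rw [RingHom.mapMatrix_apply, Matrix.map_apply, Matrix.add_apply, Matrix.smul_apply,
        Matrix.add_apply, Matrix.smul_apply, Matrix.map_apply, Matrix.map_apply, coe_evalRingHom,
        eval_add, eval_C, smul_eq_mul, smul_eq_mul, eval_mul, eval_X, eval_C, add_comm]
    rw [h1, h2, eval_eq_sum_range' (n := Module.finrank ℝ E + 1)]
    refine Nat.lt_succ_of_le ((natDegree_det_X_add_C_le _ _).trans (by simp))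

/-- There is no `C¹` retraction of a ball onto its boundary sphere. -/
theorem not_exists_contDiff_retraction {R : ℝ} (hR : 0 < R) {r : E → E} (hr : ContDiff ℝ 1 r)
    (hnorm : ∀ x, ‖r x‖ = R) (hid : ∀ x, ‖x‖ = R → r x = x) : False := by
  borelize E
  let μ : Measure E := .addHaar
  set g : E → E := fun x => r x - x with hg
  have hgC : ContDiff ℝ 1 g := hr.sub contDiff_id
  have hgd : ∀ x, HasStrictFDerivAt g (fderiv ℝ g x) x :=
    fun x => hgC.contDiffAt.hasStrictFDerivAt one_ne_zero
  have hfd : Continuous (fderiv ℝ g) := hgC.continuous_fderiv one_ne_zero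
  obtain ⟨N, c, hc, hdet⟩ := exists_det_one_add_smul_eq_sum hfd
  have hci : ∀ k, IntegrableOn (c k) (ball 0 R) μ := fun k =>
    ((hc k).continuousOn.integrableOn_compact (isCompact_closedBall 0 R)).mono_set
        ball_subset_closedBall
  let P : ℝ[X] := ∑ k ∈ Finset.range N, C (∫ x in ball 0 R, c k x ∂μ) * X ^ k
  have hP : ∀ t, P.eval t = ∫ x in ball 0 R, (1 + t • fderiv ℝ g x).det ∂μ := by
    intro t
    simp only [hdet]
    rw [integral_finsetSum _ fun k _ => (hci k).mul_const _]
    simp [P, eval_finsetSum, integral_mul_const]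
  have hball : μ.real (ball 0 R) ≠ 0 := by
    rw [measureReal_def, ENNReal.toReal_ne_zero]
    exact ⟨(measure_ball_pos μ 0 hR).ne', measure_ball_lt_top.ne⟩
  -- at `t = 1` the integrand is `det (fderiv r)`, which vanishes as `r` maps into a sphere
  have hone : P.eval 1 = 0 := by
    rw [hP, ← integral_zero E ℝ (μ := μ.restrict (ball 0 R))]
    congr 1
    ext x
    have hrd : HasFDerivAt r (1 + (1 : ℝ) • fderiv ℝ g x) x := by
      have := (hasFDerivAt_id x).add (hgd x).hasFDerivAt
      have h2 : (id + g : E → E) = r := by ext; simp [hg]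
      rw [h2] at this
      simpa using! this
    by_contra hne
    set D := (1 + (1 : ℝ) • fderiv ℝ g x) with hD
    have hsq : HasFDerivAt (fun y => ‖r y‖ ^ 2) (2 • (innerSL ℝ (r x)).comp D) x := hrd.norm_sq
    have hz : (2 • (innerSL ℝ (r x)).comp D) = 0 := by
      refine hsq.unique ?_
      simp only [hnorm]
      exact hasFDerivAt_const _ _
    have hsurj : Function.Surjective (D : E →ₗ[ℝ] E) := by
      have hu : IsUnit (LinearMap.det (D : E →ₗ[ℝ] E)) := isUnit_iff_ne_zero.2 hne
      exact ((Module.End.isUnit_iff _).1 ((LinearMap.isUnit_iff_isUnit_det _).2 hu)).2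
    obtain ⟨v, hv⟩ := hsurj (r x)
    have := congrArg (fun L : E →L[ℝ] ℝ => L v) hz
    simp only [smul_apply, ContinuousLinearMap.comp_apply] at this
    have hv' : D v = r x := hv
    rw [hv'] at this
    simp [hnorm, hR.ne'] at this
  -- for small `t` the map `x ↦ x + t • g x` is a diffeomorphism of the open ball onto itself
  obtain ⟨K, hK⟩ := (hgC.locallyLipschitz.locallyLipschitzOn
      (s := closedBall 0 R)).exists_lipschitzOnWith_of_compact
    (isCompact_closedBall 0 R)
  obtain ⟨K', hK'⟩ := (isCompact_closedBall (0 : E) R).exists_bound_of_continuousOn hfd.continuousOn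
  have hsmall : ∀ t : ℝ, 0 < t → t < 1 → t * K < 1 → t * K' < 1 → P.eval t = μ.real (ball 0 R) := by
    intro t ht0 ht1 htK htK'
    set f : E → E := fun x => x + t • g x with hf
    have hfS : ∀ x, HasStrictFDerivAt f (1 + t • fderiv ℝ g x) x :=
      fun x => (hasStrictFDerivAt_id x).add ((hgd x).const_smul t)
    have hinj : InjOn f (closedBall 0 R) := by
      intro x hx y hy hxy
      by_contra hne
      have h1 := hK.norm_sub_le hx hy
      have h2 : x - y = -(t • (g x - g y)) := by
        have : x + t • g x = y + t • g y := hxy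
        have h : x - y = (x + t • g x - (y + t • g y)) - t • (g x - g y) := by module
        rw [h, this, sub_self, zero_sub]
      have h3 : ‖x - y‖ = t * ‖g x - g y‖ := by
        rw [h2, norm_neg, norm_smul, Real.norm_of_nonneg ht0.le]
      have h4 : 0 < ‖x - y‖ := norm_pos_iff.2 (sub_ne_zero.2 hne)
      nlinarith
    have hpos : ∀ x ∈ closedBall (0 : E) R, 0 < (1 + t • fderiv ℝ g x).det := by
      intro x hx
      have hne : ∀ s ∈ Icc 0 t, (1 + s • fderiv ℝ g x).det ≠ 0 := by
        intro s hs h0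
        have := LinearMap.bot_lt_ker_of_det_eq_zero
            (f := ((1 + s • fderiv ℝ g x : E →L[ℝ] E) : E →ₗ[ℝ] E)) h0
        obtain ⟨v, hv, hv0⟩ := (Submodule.ne_bot_iff _).1 this.ne'
        have hv1 : v = -(s • fderiv ℝ g x v) := by
          rw [LinearMap.mem_ker] at hv
          have : v + s • fderiv ℝ g x v = 0 := hv
          exact eq_neg_of_add_eq_zero_left this
        have hv2 : ‖v‖ ≤ s * (K' * ‖v‖) := by
          conv_lhs => rw [hv1, norm_neg, norm_smul, Real.norm_of_nonneg hs.1]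
          gcongr
          · exact hs.1
          · exact (ContinuousLinearMap.le_opNorm _ _).trans (by gcongr; exact hK' x hx)
        have hvp := norm_pos_iff.2 hv0
        have hK0 : 0 ≤ K' := (norm_nonneg _).trans (hK' x hx)
        have : s * K' ≤ t * K' := by gcongr; exact hs.2
        nlinarith
      by_contra hle
      have hcont : ContinuousOn (fun s : ℝ => (1 + s • fderiv ℝ g x).det) (Icc 0 t) := by
        simp only [hdet]
        fun_prop
      have := intermediate_value_Icc' ht0.le hcont
      obtain ⟨s, hs, hs0⟩ := this (show (0 : ℝ) ∈ Icc _ _ from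
          ⟨not_lt.1 hle, by simp [ContinuousLinearMap.det]⟩)
      exact hne s hs hs0
    have hconv : ∀ x, f x = (1 - t) • x + t • r x := by
      intro x; simp only [hf, hg]; module
    -- the image is open, and relatively closed because `f` fixes the boundary sphere
    have himg : f '' ball 0 R = ball 0 R := by
      have hsub : f '' ball 0 R ⊆ ball 0 R := by
        rintro _ ⟨x, hx, rfl⟩
        rw [mem_ball_zero_iff] at hx ⊢
        rw [hconv]
        calc ‖(1 - t) • x + t • r x‖ ≤ (1 - t) * ‖x‖ + t * R := by
              refine (norm_add_le _ _).trans ?_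
              rw [norm_smul, norm_smul, hnorm, Real.norm_of_nonneg ht0.le, Real.norm_of_nonneg
                  (by linarith)]
          _ < R := by nlinarith
      have hopen : IsOpen (f '' ball 0 R) := by
        rw [isOpen_iff_mem_nhds]
        rintro _ ⟨x, hx, rfl⟩
        have hsurj : ((1 + t • fderiv ℝ g x : E →L[ℝ] E) : E →ₗ[ℝ] E).range = ⊤ := by
          rw [LinearMap.range_eq_top]
          have hu : IsUnit (LinearMap.det ((1 + t • fderiv ℝ g x : E →L[ℝ] E) : E →ₗ[ℝ] E)) :=
            isUnit_iff_ne_zero.2 (hpos x (ball_subset_closedBall hx)).ne'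
          exact ((Module.End.isUnit_iff _).1 ((LinearMap.isUnit_iff_isUnit_det _).2 hu)).2
        rw [← (hfS x).map_nhds_eq_of_surj hsurj]
        exact Filter.image_mem_map (isOpen_ball.mem_nhds hx)
      have hfc : Continuous f := continuous_id.add (hgC.continuous.const_smul t)
      have hclosed : IsClosed (f '' closedBall 0 R) :=
        ((isCompact_closedBall 0 R).image hfc).isClosed
      have hcl : ball 0 R ∩ f '' closedBall 0 R ⊆ f '' ball 0 R := by
        rintro _ ⟨hy, x, hx, rfl⟩
        refine ⟨x, ?_, rfl⟩
        rw [mem_closedBall_zero_iff] at hx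
        rw [mem_ball_zero_iff]
        refine lt_of_le_of_ne hx fun hxR => ?_
        have : f x = x := by rw [hconv, hid x hxR]; module
        rw [this, mem_ball_zero_iff] at hy
        exact hy.ne hxR
      refine hsub.antisymm ?_
      have hpre : IsPreconnected (ball (0 : E) R) := (convex_ball 0 R).isPreconnected
      refine hpre.subset_left_of_subset_union hopen hclosed.isOpen_compl ?_ ?_ ?_
      · rw [Set.disjoint_compl_right_iff_subset]
        exact image_mono ball_subset_closedBall
      · intro y hy
        by_cases h : y ∈ f '' closedBall 0 R
        · exact Or.inl (hcl ⟨hy, h⟩)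
        · exact Or.inr h
      · exact ⟨f 0, hsub ⟨0, mem_ball_self hR, rfl⟩, ⟨0, mem_ball_self hR, rfl⟩⟩
    have hch := lintegral_abs_det_fderiv_eq_addHaar_image μ
        (measurableSet_ball (x := (0 : E)) (ε := R))
      (fun x _ => (hfS x).hasFDerivAt.hasFDerivWithinAt) (hinj.mono ball_subset_closedBall)
    rw [himg] at hch
    rw [hP, measureReal_def, ← hch, integral_eq_lintegral_of_nonneg_ae]
    · congr 1
      refine setLIntegral_congr_fun measurableSet_ball fun x hx => ?_
      rw [abs_of_pos (hpos x (ball_subset_closedBall hx))]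
    · filter_upwards [ae_restrict_mem measurableSet_ball] with x hx
      exact (hpos x (ball_subset_closedBall hx)).le
    · simp only [hdet]
      exact (continuous_finsetSum _ fun k _ => (hc k).mul continuous_const).aestronglyMeasurable
  -- hence the polynomial is constant
  have hK'0 : 0 ≤ K' := (norm_nonneg _).trans (hK' 0 (mem_closedBall_self hR.le))
  have hconst : P = C (μ.real (ball 0 R)) := by
    refine eq_of_infinite_eval_eq _ _ (Set.Infinite.mono (s := Ioo 0 (1 / (1 + K + K'))) ?_
        (Ioo_infinite (by positivity)))
    intro t ht
    have hd : 0 < 1 + K + K' := by positivity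
    have h1 : t * (1 + K + K') < 1 := by
      have := ht.2; rwa [lt_div_iff₀ hd] at this
    have h0 := ht.1
    have hk : 0 ≤ t * K := by positivity
    have hk' : 0 ≤ t * K' := by positivity
    simp only [mem_ofPred_eq, eval_C]
    refine hsmall t h0 ?_ ?_ ?_ <;> nlinarith
  rw [hconst, eval_C] at hone
  exact hball hone

end Brouwer

/-! ### Invariance of domain -/

section InvarianceOfDomain

open MeasureTheory Metric Set

variable {E : Type*} [NormedAddCommGroup E] [InnerProductSpace ℝ E] [FiniteDimensional ℝ E]

/-- If `h` had no zero, a smooth approximation of it, divided by its norm, would be a retraction of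
a ball onto its boundary. -/
theorem exists_eq_zero_of_eq_id_outside {h : E → E} (hc : Continuous h)
    (hid : ∀ x, 1 < ‖x‖ → h x = x) : ∃ x, h x = 0 := by
  by_contra! hne
  have hU : IsOpen {x : E | 1 < ‖x‖} := isOpen_lt continuous_const continuous_norm
  obtain ⟨g, hg, hgh, hgS, -⟩ := hc.exists_contDiff_approx_and_eqOn 1 (ε := fun x => ‖h x‖)
    hc.norm (fun x => norm_pos_iff.2 (hne x)) (S := {x | 2 ≤ ‖x‖}) (U := {x | 1 < ‖x‖})
    (isClosed_le continuous_const continuous_norm)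
    (hU.mem_nhdsSet.2 fun x (hx : 2 ≤ ‖x‖) => show 1 < ‖x‖ by linarith)
    (contDiffOn_id.congr fun x hx => hid x hx)
  have hg0 : ∀ x, g x ≠ 0 := by
    intro x h0
    have := hgh x
    rw [h0, dist_zero_left] at this
    exact lt_irrefl _ this
  refine not_exists_contDiff_retraction (E := E) (R := 2) two_pos
    (r := fun x => (2 / ‖g x‖) • g x) ?_ ?_ ?_
  · exact ContDiff.smul (contDiff_const.div (hg.norm ℝ hg0) fun x => norm_ne_zero_iff.2 (hg0 x)) hg
  · intro x
    rw [norm_smul, norm_div, norm_norm, div_mul_cancel₀ _ (norm_ne_zero_iff.2 (hg0 x))]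
    simp
  · intro x hx
    have h1 : g x = x := (hgS (show 2 ≤ ‖x‖ from hx.ge)).trans (hid x (by linarith))
    simp [h1, hx]

/-- A map of the closed unit ball that moves points by at most `1 / 2` has a zero. This is a form of
Brouwer's fixed point theorem. The proof extends the map to the whole space by damping the
displacement `h x - x` outside the ball. -/
theorem exists_eq_zero_of_norm_sub_le {h : E → E} (hc : ContinuousOn h (closedBall 0 1))
    (hd : ∀ x ∈ closedBall (0 : E) 1, ‖h x - x‖ ≤ 1 / 2) : ∃ x ∈ closedBall (0 : E) 1, h x = 0 := by
  set π : E → E := fun x => (max 1 ‖x‖)⁻¹ • x with hπ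
  have hm : ∀ x : E, (0 : ℝ) < max 1 ‖x‖ := fun x => lt_max_of_lt_left one_pos
  have hπc : Continuous π :=
    ((continuous_const.max continuous_norm).inv₀ fun x => (hm x).ne').smul continuous_id
  have hπm : ∀ x, π x ∈ closedBall (0 : E) 1 := by
    intro x
    rw [mem_closedBall_zero_iff, hπ]
    simp only [norm_smul, norm_inv, Real.norm_of_nonneg (hm x).le]
    rw [inv_mul_le_iff₀ (hm x), mul_one]
    exact le_max_right _ _
  set χ : E → ℝ := fun x => min 1 (max 0 (2 - 2 * ‖x‖)) with hχ
  have hχc : Continuous χ := by fun_prop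
  have hχ0 : ∀ x, 0 ≤ χ x := fun x => le_min zero_le_one (le_max_left _ _)
  obtain ⟨x, hx⟩ := exists_eq_zero_of_eq_id_outside (E := E)
    (h := fun x => x + χ x • (h (π x) - π x))
    (continuous_id.add (hχc.smul ((hc.comp_continuous hπc hπm).sub hπc))) (by
      intro x hx
      have : χ x = 0 := by
        simp only [hχ]
        rw [max_eq_left (by linarith), min_eq_right zero_le_one]
      simp [this])
  have hx2 : ‖x‖ ≤ 1 / 2 := by
    have h1 : x = -(χ x • (h (π x) - π x)) := eq_neg_of_add_eq_zero_left hx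
    calc ‖x‖ = χ x * ‖h (π x) - π x‖ := by
          conv_lhs => rw [h1, norm_neg, norm_smul, Real.norm_of_nonneg (hχ0 x)]
      _ ≤ 1 * (1 / 2) := mul_le_mul (min_le_left _ _) (hd _ (hπm x)) (norm_nonneg _) zero_le_one
      _ = 1 / 2 := one_mul _
  have h1 : χ x = 1 := by
    simp only [hχ]
    exact min_eq_left (le_max_of_le_right (by linarith))
  have h2 : π x = x := by
    simp only [hπ]
    rw [max_eq_left (by linarith), inv_one, one_smul]
  refine ⟨x, by rw [mem_closedBall_zero_iff]; linarith, ?_⟩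
  simpa [h1, h2] using hx

/-- The core of invariance of domain. Let `G` be a continuous extension of the inverse of `f` and
suppose that `f 0` is not interior to the image of `f`. Push the image of `f` away from a nearby
point `c` not in it, onto the set `S` of its points at distance at least `ε` from `c` and the
sphere of radius `ε` around `c`. There a perturbation `Q` of `G` has no zeros: on `S` because `G`
has none, on the sphere because its image under a smooth map is a null set. The composite is close
to the identity and nowhere zero, against `exists_eq_zero_of_norm_sub_le`. -/
theorem image_closedBall_mem_nhds [Nontrivial E] {f : E → E} (hf : ContinuousOn f (closedBall 0 1))
    (hinj : InjOn f (closedBall 0 1)) : f '' closedBall 0 1 ∈ nhds (f 0) := by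
  borelize E
  let μ : Measure E := .addHaar
  have : TietzeExtension E := TietzeExtension.of_tvs ℝ
  set B : Set E := closedBall 0 1 with hB
  have hBc : IsCompact B := isCompact_closedBall 0 1
  have h0B : (0 : E) ∈ B := mem_closedBall_self zero_le_one
  have : CompactSpace B := isCompact_iff_compactSpace.1 hBc
  have hcl : Topology.IsClosedEmbedding (B.domRestrict f) :=
    hf.domRestrict.isClosedEmbedding (injOn_iff_injective.1 hinj)
  obtain ⟨G, hG⟩ := ContinuousMap.exists_extension hcl
      (⟨Subtype.val, continuous_subtype_val⟩ : C(B, E))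
  have hGf : ∀ x ∈ B, G (f x) = x := fun x hx => DFunLike.congr_fun hG ⟨x, hx⟩
  by_contra hnot
  obtain ⟨ε, hε, hGε⟩ : ∃ ε > 0, ∀ y, dist y (f 0) < 2 * ε → ‖G y‖ < 1 / 10 := by
    have : Filter.Tendsto (fun y => ‖G y‖) (nhds (f 0)) (nhds ‖G (f 0)‖) :=
        G.continuous.norm.tendsto _
    rw [hGf 0 h0B, norm_zero] at this
    obtain ⟨η, hη, h⟩ := Metric.eventually_nhds_iff.1
        (this.eventually_lt_const (u := 1 / 10) (by norm_num))
    exact ⟨η / 2, half_pos hη, fun y hy => h (by linarith)⟩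
  obtain ⟨c, hcε, hcK⟩ : ∃ c, dist c (f 0) < ε ∧ c ∉ f '' B := by
    by_contra! h
    exact hnot (Filter.mem_of_superset (ball_mem_nhds _ hε) fun y hy => h y hy)
  have hKc : IsCompact (f '' B) := hBc.image_of_continuousOn hf
  set S : Set E := f '' B ∩ {y | ε ≤ dist y c} with hS
  have hSc : IsCompact S := hKc.inter_right (isClosed_le continuous_const
      (continuous_id.dist continuous_const))
  have hGS : ∀ y ∈ S, 0 < ‖G y‖ := by
    rintro _ ⟨⟨x, hx, rfl⟩, hy⟩
    rw [norm_pos_iff, hGf x hx]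
    rintro rfl
    rw [mem_ofPred_eq, dist_comm] at hy
    linarith
  obtain ⟨δ, hδ, hGδ⟩ := hSc.exists_forall_le' G.continuous.norm.continuousOn hGS
  set δ' := min δ (1 / 10)
  have hδ' : 0 < δ' := lt_min hδ (by norm_num)
  obtain ⟨P, hP, hPG, -⟩ := G.continuous.exists_contDiff_approx 1 (ε := fun _ => δ' / 2)
    continuous_const (fun _ => half_pos hδ')
  -- the image of the sphere is a null set, so a small translation moves it off the origin
  obtain ⟨v, hv, hvS⟩ : ∃ v ∈ ball (0 : E) (δ' / 2), v ∉ P '' sphere c ε := by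
    by_contra! h
    have h0 : μ (P '' sphere c ε) = 0 :=
      addHaar_image_eq_zero_of_differentiableOn_of_addHaar_eq_zero μ
        (hP.differentiable one_ne_zero).differentiableOn (Measure.addHaar_sphere μ c ε)
    exact (measure_ball_pos μ 0 (half_pos hδ')).ne' (measure_mono_null h h0)
  rw [mem_ball_zero_iff] at hv
  set Q : E → E := fun y => P y - v with hQ
  have hQG : ∀ y, ‖Q y - G y‖ < δ' := by
    intro y
    have h1 := hPG y
    rw [dist_eq_norm] at h1
    have h2 : Q y - G y = (P y - G y) - v := by simp only [hQ]; abel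
    rw [h2]
    linarith [norm_sub_le (P y - G y) v]
  have hQS : ∀ y ∈ S, Q y ≠ 0 := by
    intro y hy h0
    have h1 := hQG y
    rw [h0, zero_sub, norm_neg] at h1
    linarith [hGδ y hy, min_le_left δ (1 / 10)]
  have hQs : ∀ y ∈ sphere c ε, Q y ≠ 0 := fun y hy h0 => hvS ⟨y, hy, sub_eq_zero.1 h0⟩
  set Φ : E → E := fun y => c + (max 1 (ε / ‖y - c‖)) • (y - c) with hΦ
  have hΦfar : ∀ y, ε ≤ dist y c → Φ y = y := by
    intro y hy
    rw [dist_eq_norm] at hy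
    have : ε / ‖y - c‖ ≤ 1 := div_le_one_of_le₀ hy (norm_nonneg _)
    simp [hΦ, max_eq_left this]
  have hΦnear : ∀ y, y ≠ c → dist y c ≤ ε → Φ y ∈ sphere c ε := by
    intro y hyc hy
    rw [dist_eq_norm] at hy
    have hpos : 0 < ‖y - c‖ := norm_pos_iff.2 (sub_ne_zero.2 hyc)
    have : 1 ≤ ε / ‖y - c‖ := (one_le_div hpos).2 hy
    rw [mem_sphere, dist_eq_norm]
    simp only [hΦ, max_eq_right this, add_sub_cancel_left]
    rw [norm_smul, Real.norm_of_nonneg (by positivity), div_mul_cancel₀ _ hpos.ne']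
  have hne : ∀ x ∈ B, f x - c ≠ 0 := fun x hx h => hcK ⟨x, hx, sub_eq_zero.1 h⟩
  obtain ⟨x, hx, hx0⟩ := exists_eq_zero_of_norm_sub_le (E := E) (h := fun x => Q (Φ (f x))) (by
      have hfc : ContinuousOn (fun x => f x - c) B := hf.sub continuousOn_const
      have h1 : ContinuousOn (fun x => Φ (f x)) B :=
        continuousOn_const.add ((continuousOn_const.sup (continuousOn_const.div hfc.norm
          fun x hx => norm_ne_zero_iff.2 (hne x hx))).smul hfc)
      exact (hP.continuous.sub continuous_const).comp_continuousOn h1) (by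
      intro x hx
      have hδ1 := min_le_right δ (1 / 10)
      rcases le_or_gt ε (dist (f x) c) with h | h
      · simp only [hΦfar _ h]
        have := hQG (f x)
        rw [hGf x hx] at this
        linarith
      · have hs := hΦnear (f x) (fun h => hne x hx (sub_eq_zero.2 h)) h.le
        rw [mem_sphere] at hs
        have h1 := hQG (Φ (f x))
        have h2 := hGε (Φ (f x)) (by linarith [dist_triangle (Φ (f x)) c (f 0)])
        have h3 := hGε (f x) (by linarith [dist_triangle (f x) c (f 0)])
        rw [hGf x hx] at h3
        have h4 : Q (Φ (f x)) - x = (Q (Φ (f x)) - G (Φ (f x))) + G (Φ (f x)) - x := by abel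
        rw [h4]
        linarith [norm_sub_le ((Q (Φ (f x)) - G (Φ (f x))) + G (Φ (f x))) x,
          norm_add_le (Q (Φ (f x)) - G (Φ (f x))) (G (Φ (f x)))])
  rcases le_or_gt ε (dist (f x) c) with h | h
  · rw [hΦfar _ h] at hx0
    exact hQS _ ⟨⟨x, hx, rfl⟩, h⟩ hx0
  · exact hQs _ (hΦnear (f x) (fun h => hne x hx (sub_eq_zero.2 h)) h.le) hx0

/-- **Invariance of domain.** -/
theorem isOpen_image_of_continuousOn_injOn [Nontrivial E] {f : E → E} {U : Set E} (hU : IsOpen U)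
    (hf : ContinuousOn f U) (hinj : InjOn f U) : IsOpen (f '' U) := by
  rw [isOpen_iff_mem_nhds]
  rintro _ ⟨x, hx, rfl⟩
  obtain ⟨ρ, hρ, hsub⟩ := Metric.nhds_basis_closedBall.mem_iff.1 (hU.mem_nhds hx)
  have hmaps : MapsTo (fun y : E => x + ρ • y) (closedBall 0 1) U := by
    intro y hy
    refine hsub ?_
    rw [mem_closedBall_zero_iff] at hy
    rw [mem_closedBall, dist_eq_norm, add_sub_cancel_left, norm_smul, Real.norm_of_nonneg hρ.le]
    nlinarith
  have hc : Continuous (fun y : E => x + ρ • y) := by fun_prop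
  have := image_closedBall_mem_nhds (f := fun y => f (x + ρ • y))
    (hf.comp hc.continuousOn hmaps) (fun y hy z hz hyz => by
      have := hinj (hmaps hy) (hmaps hz) hyz
      exact smul_right_injective E hρ.ne' (add_left_cancel this))
  simp only [smul_zero, add_zero] at this
  refine Filter.mem_of_superset this ?_
  rintro _ ⟨y, hy, rfl⟩
  exact ⟨_, hmaps hy, rfl⟩

end InvarianceOfDomain

/-! ### Level sets separating two unbounded connected sets -/

section Crossing

open Metric Set Filter Topology

/-- A real function on a connected set stays inside an interval whose end points it avoids. -/
theorem mem_Ioo_of_isPreconnected {X : Type*} [TopologicalSpace X] {s : Set X}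
    (hs : IsPreconnected s) {φ : X → ℝ} (hφ : Continuous φ) {a b : ℝ} (ha : ∀ z ∈ s, φ z ≠ a)
    (hb : ∀ z ∈ s, φ z ≠ b) {x y : X} (hx : x ∈ s) (hy : y ∈ s) (hxI : φ x ∈ Ioo a b) :
    φ y ∈ Ioo a b := by
  have hpre := (hs.image φ hφ.continuousOn).ordConnected
  by_contra hn
  rw [mem_Ioo, not_and_or, not_lt, not_lt] at hn
  rcases hn with h | h
  · obtain ⟨z, hz, hza⟩ := hpre.out ⟨y, hy, rfl⟩ ⟨x, hx, rfl⟩ ⟨h, hxI.1.le⟩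
    exact ha z hz hza
  · obtain ⟨z, hz, hzb⟩ := hpre.out ⟨x, hx, rfl⟩ ⟨y, hy, rfl⟩ ⟨hxI.2.le, h⟩
    exact hb z hz hzb

/-- The winding number obstruction: a nowhere zero function on a simply connected space cannot
run once around the origin along a cyclic chain of four connected sets. -/
theorem false_of_winding {X : Type*} [TopologicalSpace X] [SimplyConnectedSpace X]
    [LocallyPathConnectedSpace X] {u v : X → ℝ} (hu : Continuous u) (hv : Continuous v)
    (h0 : ∀ x, u x = 0 → v x ≠ 0) {s₁ s₂ s₃ s₄ : Set X} (h₁ : IsPreconnected s₁)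
    (h₂ : IsPreconnected s₂) (h₃ : IsPreconnected s₃) (h₄ : IsPreconnected s₄)
    (hu₁ : ∀ x ∈ s₁, u x < 0) (hv₂ : ∀ x ∈ s₂, v x < 0) (hu₃ : ∀ x ∈ s₃, 0 < u x)
    (hv₄ : ∀ x ∈ s₄, 0 < v x) (h₁₂ : (s₁ ∩ s₂).Nonempty) (h₂₃ : (s₂ ∩ s₃).Nonempty)
    (h₃₄ : (s₃ ∩ s₄).Nonempty) (h₄₁ : (s₄ ∩ s₁).Nonempty) : False := by
  obtain ⟨a, ha₁, ha₂⟩ := h₁₂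
  obtain ⟨b, hb₂, hb₃⟩ := h₂₃
  obtain ⟨c, hc₃, hc₄⟩ := h₃₄
  obtain ⟨d, hd₄, hd₁⟩ := h₄₁
  let F : C(X, ℂ) := ⟨fun x => u x + v x * Complex.I, by fun_prop⟩
  have hF : ∀ x, F x ∈ ({0}ᶜ : Set ℂ) := by
    intro x hx
    have hx' : (u x + v x * Complex.I : ℂ) = 0 := hx
    have hre := congrArg Complex.re hx'
    have him := congrArg Complex.im hx'
    simp at hre him
    exact h0 x hre him
  obtain ⟨Θ, ⟨-, hΘ⟩, -⟩ := Complex.isCoveringMapOn_exp.existsUnique_continuousMap_lifts F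
    (a₀ := a) (e₀ := Complex.log (F a)) (Complex.exp_log (hF a)) hF
  -- `φ` is the lifted angle, normalized at `a`; it would increase by `2π` along the chain
  obtain ⟨k, hk, -⟩ := existsUnique_sub_zsmul_mem_Ico Real.two_pi_pos (Θ a).im 0
  set φ : X → ℝ := fun x => (Θ x).im - k • (2 * Real.pi) with hφ
  have hφc : Continuous φ := (Complex.continuous_im.comp Θ.continuous).sub continuous_const
  have hcos : ∀ x, u x = Real.exp (Θ x).re * Real.cos (φ x) := by
    intro x
    have := congrArg Complex.re (congrFun hΘ x)
    simp only [F, Function.comp_apply, Complex.exp_re, ContinuousMap.coe_mk] at this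
    simp only [hφ, zsmul_eq_mul, Real.cos_sub_int_mul_two_pi, this]
    simp
  have hsin : ∀ x, v x = Real.exp (Θ x).re * Real.sin (φ x) := by
    intro x
    have := congrArg Complex.im (congrFun hΘ x)
    simp only [F, Function.comp_apply, Complex.exp_im, ContinuousMap.coe_mk] at this
    simp only [hφ, zsmul_eq_mul, Real.sin_sub_int_mul_two_pi, this]
    simp
  have c₁ : ∀ x ∈ s₁, Real.cos (φ x) < 0 := fun x hx => by
    have := hu₁ x hx
    rw [hcos] at this
    exact (smul_neg_iff_of_pos_left (Real.exp_pos _)).1 this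
  have c₂ : ∀ x ∈ s₂, Real.sin (φ x) < 0 := fun x hx => by
    have := hv₂ x hx
    rw [hsin] at this
    exact (smul_neg_iff_of_pos_left (Real.exp_pos _)).1 this
  have c₃ : ∀ x ∈ s₃, 0 < Real.cos (φ x) := fun x hx => by
    have := hu₃ x hx
    rw [hcos] at this
    exact (mul_pos_iff_of_pos_left (Real.exp_pos _)).1 this
  have c₄ : ∀ x ∈ s₄, 0 < Real.sin (φ x) := fun x hx => by
    have := hv₄ x hx
    rw [hsin] at this
    exact (mul_pos_iff_of_pos_left (Real.exp_pos _)).1 this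
  have hπ := Real.pi_pos
  have C1 : Real.cos (3 * Real.pi / 2) = 0 := by
    rw [show 3 * Real.pi / 2 = Real.pi / 2 + Real.pi by ring, Real.cos_add_pi, Real.cos_pi_div_two,
        neg_zero]
  have C2 : Real.cos (5 * Real.pi / 2) = 0 := by
    rw [show 5 * Real.pi / 2 = Real.pi / 2 + 2 * Real.pi by ring, Real.cos_add_two_pi,
        Real.cos_pi_div_two]
  have C3 : Real.cos (7 * Real.pi / 2) = 0 := by
    rw [show 7 * Real.pi / 2 = 3 * Real.pi / 2 + 2 * Real.pi by ring, Real.cos_add_two_pi, C1]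
  have S2 : Real.sin (3 * Real.pi) = 0 := by
    rw [show 3 * Real.pi = Real.pi + 2 * Real.pi by ring, Real.sin_add_two_pi, Real.sin_pi]
  have A : φ a ∈ Ioo Real.pi (2 * Real.pi) := by
    have h1 : φ a ∈ Ico 0 (2 * Real.pi) := by simpa [hφ] using hk
    refine ⟨not_le.1 fun h => ?_, h1.2⟩
    exact (c₂ a ha₂).not_ge (Real.sin_nonneg_of_nonneg_of_le_pi h1.1 h)
  have B := mem_Ioo_of_isPreconnected h₂ hφc (a := Real.pi) (b := 2 * Real.pi)
    (fun z hz h => by have := c₂ z hz; simp [h] at this)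
    (fun z hz h => by have := c₂ z hz; simp [h] at this) ha₂ hb₂ A
  have B' : φ b ∈ Ioo (3 * Real.pi / 2) (5 * Real.pi / 2) := by
    refine ⟨not_le.1 fun h => ?_, by linarith [B.2]⟩
    exact (c₃ b hb₃).not_ge (Real.cos_nonpos_of_pi_div_two_le_of_le (by linarith [B.1])
        (by linarith))
  have Cc := mem_Ioo_of_isPreconnected h₃ hφc (a := 3 * Real.pi / 2) (b := 5 * Real.pi / 2)
    (fun z hz h => by have := c₃ z hz; rw [h, C1] at this; exact lt_irrefl _ this)
    (fun z hz h => by have := c₃ z hz; rw [h, C2] at this; exact lt_irrefl _ this) hb₃ hc₃ B'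
  have Cc' : φ c ∈ Ioo (2 * Real.pi) (3 * Real.pi) := by
    refine ⟨not_le.1 fun h => ?_, by linarith [Cc.2]⟩
    have := c₄ c hc₄
    rw [← Real.sin_sub_two_pi] at this
    exact this.not_ge (Real.sin_nonpos_of_nonpos_of_neg_pi_le (by linarith) (by linarith [Cc.1]))
  have D := mem_Ioo_of_isPreconnected h₄ hφc (a := 2 * Real.pi) (b := 3 * Real.pi)
    (fun z hz h => by have := c₄ z hz; simp [h] at this)
    (fun z hz h => by have := c₄ z hz; rw [h, S2] at this; exact lt_irrefl _ this) hc₄ hd₄ Cc'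
  have D' : φ d ∈ Ioo (5 * Real.pi / 2) (7 * Real.pi / 2) := by
    refine ⟨not_le.1 fun h => ?_, by linarith [D.2]⟩
    have := c₁ d hd₁
    rw [← Real.cos_sub_two_pi] at this
    exact this.not_ge (Real.cos_nonneg_of_neg_pi_div_two_le_of_le (by linarith [D.1]) (by linarith))
  have A' := mem_Ioo_of_isPreconnected h₁ hφc (a := 5 * Real.pi / 2) (b := 7 * Real.pi / 2)
    (fun z hz h => by have := c₁ z hz; rw [h, C2] at this; exact lt_irrefl _ this)
    (fun z hz h => by have := c₁ z hz; rw [h, C3] at this; exact lt_irrefl _ this) hd₁ ha₁ D'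
  linarith [A.2, A'.1]

/-- A path starting inside the ball of radius `a` and ending outside has a last time at which its
norm is `a`. -/
theorem exists_last_norm_eq {E : Type*} [SeminormedAddGroup E] {γ : unitInterval → E}
    (hγ : Continuous γ) {a : ℝ} (h0 : ‖γ 0‖ ≤ a)
    (h1 : a ≤ ‖γ 1‖) : ∃ s, ‖γ s‖ = a ∧ ∀ t, s ≤ t → a ≤ ‖γ t‖ := by
  have hc : IsCompact {s | ‖γ s‖ ≤ a} := (isClosed_le hγ.norm continuous_const).isCompact
  obtain ⟨s, hs, hmax⟩ := hc.exists_isGreatest ⟨0, h0⟩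
  have hsa : ‖γ s‖ = a := by
    have hI : IsPreconnected (Icc s 1) := isPreconnected_Icc
    obtain ⟨t, ht, hta⟩ := (hI.image (fun t => ‖γ t‖) hγ.norm.continuousOn).ordConnected.out
      ⟨s, ⟨le_rfl, unitInterval.le_one'⟩, rfl⟩ ⟨1, ⟨unitInterval.le_one', le_rfl⟩, rfl⟩ ⟨hs, h1⟩
    have : t = s := le_antisymm (hmax hta.le) ht.1
    rwa [this] at hta
  refine ⟨s, hsa, fun t ht => ?_⟩
  by_contra! h
  have : t = s := le_antisymm (hmax h.le) ht
  rw [this, hsa] at h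
  exact lt_irrefl _ h

variable {E : Type*} [NormedAddCommGroup E] [NormedSpace ℝ E]

/-- A level set separating two unbounded connected sets cannot be bounded: its neighbourhood
contains paths reaching arbitrarily far. -/
theorem exists_joinedIn_level (hE : 1 < Module.rank ℝ E) {f : E → ℝ} (hf : Continuous f)
    {G H : Set E} (hG : IsPreconnected G) (hH : IsPreconnected H) (hfG : ∀ x ∈ G, f x < 0)
    (hfH : ∀ x ∈ H, 0 < f x) {ρ T : ℝ} (hρT : ρ < T)
    (hGρ : (closedBall 0 ρ ∩ G).Nonempty) (hHρ : (closedBall 0 ρ ∩ H).Nonempty)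
    (hGT : ∃ x ∈ G, T ≤ ‖x‖) (hHT : ∃ x ∈ H, T ≤ ‖x‖) {ε : ℝ} (hε : 0 < ε) :
    ∃ x y, ‖x‖ ≤ ρ ∧ T ≤ ‖y‖ ∧ JoinedIn {z | |f z| < ε} x y := by
  by_contra! hcon
  have hρ : 0 ≤ ρ := by
    obtain ⟨x, hx, -⟩ := hGρ
    exact (norm_nonneg x).trans (mem_closedBall_zero_iff.1 hx)
  set V : Set E := {z | |f z| < ε} with hVdef
  have hV : IsOpen V := isOpen_lt hf.abs continuous_const
  -- the part of `V` that can be reached from the ball, by assumption contained in `ball 0 T`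
  set U : Set E := {y | ∃ x, ‖x‖ ≤ ρ ∧ JoinedIn V x y} with hU
  have hUV : U ⊆ V := fun y ⟨x, _, h⟩ => h.target_mem
  have hUo : IsOpen U := by
    rw [isOpen_iff_mem_nhds]
    rintro y ⟨x, hx, hxy⟩
    refine Filter.mem_of_superset ((hV.pathComponentIn y).mem_nhds
      (mem_pathComponentIn_self hxy.target_mem)) ?_
    intro z hz
    exact ⟨x, hx, hxy.trans hz⟩
  have hVUo : IsOpen (V \ U) := by
    rw [isOpen_iff_mem_nhds]
    rintro y ⟨hy, hyU⟩
    refine Filter.mem_of_superset ((hV.pathComponentIn y).mem_nhds (mem_pathComponentIn_self hy)) ?_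
    intro z hz
    have hz' : JoinedIn V y z := hz
    exact ⟨hz'.target_mem, fun ⟨x, hx, hxz⟩ => hyU ⟨x, hx, hxz.trans hz'.symm⟩⟩
  have hZ : IsClosed {z | f z = 0} := isClosed_eq hf continuous_const
  have hZV : ∀ z, f z = 0 → z ∈ V := fun z hz => by simp [hVdef, hz, hε]
  have hS1 : IsClosed (({z | f z = 0} ∩ (V \ U)ᶜ) ∪ closedBall 0 ρ) :=
    (hZ.inter hVUo.isClosed_compl).union isClosed_closedBall
  have hS2 : IsClosed (({z | f z = 0} ∩ Uᶜ) ∪ sphere 0 T) :=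
    (hZ.inter hUo.isClosed_compl).union isClosed_sphere
  have hdisj : Disjoint (({z | f z = 0} ∩ (V \ U)ᶜ) ∪ closedBall 0 ρ)
      (({z | f z = 0} ∩ Uᶜ) ∪ sphere 0 T) := by
    rw [Set.disjoint_left]
    have hself : ∀ z, z ∈ V → ‖z‖ ≤ ρ → z ∈ U := fun z hz h => ⟨z, h, JoinedIn.refl hz⟩
    rintro z (⟨hz, hzU⟩ | hz) (⟨hz', hzU'⟩ | hz')
    · exact hzU ⟨hZV z hz, hzU'⟩
    · have hzU2 : z ∈ U := by
        by_contra h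
        exact hzU ⟨hZV z hz, h⟩
      obtain ⟨x, hx, hxz⟩ := hzU2
      exact hcon x z hx (mem_sphere_zero_iff_norm.1 hz').ge hxz
    · exact hzU' (hself z (hZV z hz') (mem_closedBall_zero_iff.1 hz))
    · rw [mem_closedBall_zero_iff] at hz
      rw [mem_sphere_zero_iff_norm] at hz'
      linarith
  obtain ⟨u, hu1, hu2, -⟩ := exists_continuous_zero_one_of_isClosed hS1 hS2 hdisj
  -- `2 * u - 1` is `-1` on the small ball and `1` on the large sphere, and `±1` where `f` vanishes
  have hmeet : ∀ K : Set E, IsPreconnected K → (closedBall 0 ρ ∩ K).Nonempty → (∃ x ∈ K, T ≤ ‖x‖) →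
      ∃ x ∈ K, ‖x‖ = T := by
    rintro K hK ⟨x, hx, hxK⟩ ⟨y, hyK, hy⟩
    rw [mem_closedBall_zero_iff] at hx
    exact (hK.image norm continuous_norm.continuousOn).ordConnected.out ⟨x, hxK, rfl⟩ ⟨y, hyK, rfl⟩
      ⟨by linarith, hy⟩
  have : LocallyPathConnectedSpace E := inferInstance
  obtain ⟨p, hpG, hp⟩ := hmeet G hG hGρ hGT
  obtain ⟨q, hqH, hq⟩ := hmeet H hH hHρ hHT
  refine false_of_winding (u := fun x => 2 * u x - 1) (v := f) (by fun_prop) hf ?_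
    (s₁ := closedBall 0 ρ) (s₂ := G) (s₃ := sphere 0 T) (s₄ := H)
    (convex_closedBall 0 ρ).isPreconnected hG (isPreconnected_sphere hE 0 T) hH
    ?_ hfG ?_ hfH hGρ ⟨p, hpG, by simpa using hp⟩ ⟨q, by simpa using hq, hqH⟩
    (by rwa [inter_comm])
  · intro x hx hfx
    by_cases hxU : x ∈ U
    · have := hu1 (Or.inl ⟨hfx, fun h => h.2 hxU⟩)
      simp only [this, Pi.zero_apply] at hx
      norm_num at hx
    · have := hu2 (Or.inl ⟨hfx, hxU⟩)
      simp only [this, Pi.one_apply] at hx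
      norm_num at hx
  · intro x hx
    simp [hu1 (Or.inr hx)]
  · intro x hx
    simp only [hu2 (Or.inr hx), Pi.one_apply]
    norm_num

/-- The far-reaching paths of `exists_joinedIn_level` accumulate: the points of last crossing of the
spheres of radius `ρ + 1 + k` converge along an ultrafilter, simultaneously for all `k`, and small
balls around the limits connect these to the paths. -/
theorem exists_joinedIn_sequence [FiniteDimensional ℝ E] (hE : 1 < Module.rank ℝ E) {f : E → ℝ}
    (hf : Continuous f) {G H : Set E} (hG : IsPreconnected G) (hH : IsPreconnected H)
    (hfG : ∀ x ∈ G, f x < 0) (hfH : ∀ x ∈ H, 0 < f x) (hGu : ¬ Bornology.IsBounded G)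
    (hHu : ¬ Bornology.IsBounded H) {ε : ℝ} (hε : 0 < ε) :
    ∃ y : ℕ → E, ∀ k : ℕ, JoinedIn {z | |f z| < ε ∧ k < ‖z‖} (y k) (y (k + 1)) := by
  have hunb : ∀ K : Set E, ¬ Bornology.IsBounded K → ∀ T : ℝ, ∃ x ∈ K, T ≤ ‖x‖ := by
    intro K hK T
    by_contra! h
    exact hK (isBounded_iff_forall_norm_le.2 ⟨T, fun x hx => (h x hx).le⟩)
  obtain ⟨p, hp, -⟩ := hunb G hGu 0
  obtain ⟨q, hq, -⟩ := hunb H hHu 0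
  set ρ := max ‖p‖ ‖q‖ with hρ
  have hρ0 : 0 ≤ ρ := (norm_nonneg p).trans (le_max_left _ _)
  have hpath : ∀ N : ℕ, ∃ x y, ‖x‖ ≤ ρ ∧ ρ + 1 + N ≤ ‖y‖ ∧ JoinedIn {z | |f z| < ε / 2} x y := by
    intro N
    refine exists_joinedIn_level hE hf hG hH hfG hfH
        (by have : (0:ℝ) ≤ N := N.cast_nonneg; linarith)
      ⟨p, ?_, hp⟩ ⟨q, ?_, hq⟩ (hunb G hGu _) (hunb H hHu _) (half_pos hε)
    · rw [mem_closedBall_zero_iff]; exact le_max_left _ _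
    · rw [mem_closedBall_zero_iff]; exact le_max_right _ _
  -- `z N k` is the point where the `N`-th path last crosses the sphere of radius `ρ + 1 + k`
  have hcross : ∀ N : ℕ, ∃ z : ℕ → E, ∀ k, k < N → ‖z k‖ = ρ + 1 + k ∧ ‖z (k + 1)‖ = ρ + 1 +
      (k + 1 : ℕ) ∧
      JoinedIn {z | |f z| < ε / 2 ∧ ρ + 1 + k ≤ ‖z‖} (z k) (z (k + 1)) := by
    intro N
    obtain ⟨x, y, hx, hy, hxy⟩ := hpath N
    set γ := hxy.somePath
    have hs : ∀ k : ℕ, ∃ s, k ≤ N → ‖γ s‖ = ρ + 1 + k ∧ ∀ t, s ≤ t → ρ + 1 + k ≤ ‖γ t‖ := by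
      intro k
      by_cases hk : k ≤ N
      · have hk' : (k : ℝ) ≤ N := Nat.cast_le.2 hk
        have hk0 : (0 : ℝ) ≤ k := k.cast_nonneg
        obtain ⟨s, hs⟩ := exists_last_norm_eq γ.continuous (a := ρ + 1 + k)
          (by rw [γ.source]; linarith) (by rw [γ.target]; linarith)
        exact ⟨s, fun _ => hs⟩
      · exact ⟨0, fun h => absurd h hk⟩
    choose s hs using hs
    refine ⟨fun k => γ (s k), fun k hk => ⟨(hs k hk.le).1, (hs (k + 1) hk).1, ?_⟩⟩
    have hle : s k ≤ s (k + 1) := by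
      by_contra! h
      have h1 := (hs (k + 1) hk).2 (s k) h.le
      rw [(hs k hk.le).1] at h1
      push_cast at h1
      linarith
    refine JoinedIn.ofLine (f := fun t : ℝ => γ (projIcc 0 1 zero_le_one
        (s k + t * (s (k + 1) - s k)))) ?_ ?_ ?_ ?_
    · exact (γ.continuous.comp (continuous_projIcc.comp (by fun_prop))).continuousOn
    · simp
    · simp
    · rintro _ ⟨t, ht, rfl⟩
      have h1 : (s k : ℝ) ≤ s (k + 1) := hle
      refine ⟨hxy.somePath_mem _, (hs k hk.le).2 _ ?_⟩
      rw [← Subtype.coe_le_coe, coe_projIcc]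
      refine le_max_of_le_right (le_min (s k).2.2 ?_)
      nlinarith [ht.1]
  choose z hz using hcross
  -- an ultrafilter gives limits for all `k` at once
  set 𝒰 : Ultrafilter ℕ := hyperfilter ℕ
  have hlarge : ∀ k : ℕ, ∀ᶠ N in (𝒰 : Filter ℕ), k < N := fun k =>
    Nat.hyperfilter_le_atTop (eventually_gt_atTop k)
  have hlim : ∀ k : ℕ, ∃ y, ‖y‖ = ρ + 1 + k ∧ |f y| ≤ ε / 2 ∧ Tendsto (fun N => z N k) 𝒰 (𝓝 y) := by
    intro k
    have hcomp : IsCompact (sphere (0 : E) (ρ + 1 + k) ∩ {z | |f z| ≤ ε / 2}) :=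
      (isCompact_sphere 0 _).inter_right (isClosed_le hf.abs continuous_const)
    obtain ⟨y, hy, hlim⟩ := hcomp.ultrafilter_le_nhds (𝒰.map fun N => z N k) (by
      rw [le_principal_iff, Ultrafilter.mem_coe, Ultrafilter.mem_map]
      filter_upwards [hlarge k] with N hN
      obtain ⟨h1, -, h3⟩ := hz N k hN
      exact ⟨by simpa using h1, h3.source_mem.1.le⟩)
    exact ⟨y, by simpa using hy.1, hy.2, hlim⟩
  choose y hy1 hy2 hy3 using hlim
  set W : ℕ → Set E := fun k => {z | |f z| < ε ∧ k < ‖z‖} with hW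
  have hWo : ∀ k, IsOpen (W k) := fun k =>
    (isOpen_lt hf.abs continuous_const).inter (isOpen_lt continuous_const continuous_norm)
  have hyW : ∀ k, y k ∈ W k := fun k =>
    ⟨by linarith [hy2 k], by rw [hy1]; linarith⟩
  have hWanti : ∀ k, W (k + 1) ⊆ W k := fun k x hx => ⟨hx.1, by
    have := hx.2; push_cast at this; linarith⟩
  refine ⟨y, fun k => ?_⟩
  have hnear : ∀ k, ∀ᶠ N in (𝒰 : Filter ℕ), JoinedIn (W k) (y k) (z N k) := fun k =>
    (hy3 k).eventually (((hWo k).pathComponentIn (y k)).mem_nhds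
      (mem_pathComponentIn_self (hyW k)))
  obtain ⟨N, h1, h2, h3⟩ := ((hnear k).and ((hnear (k + 1)).and (hlarge k))).exists
  refine h1.trans (((hz N k h3).2.2.mono ?_).trans (h2.symm.mono (hWanti k)))
  rintro x ⟨hx1, hx2⟩
  exact ⟨by linarith, by linarith⟩

end Crossing

/-! ### Escaping chains in an intersection of open cells -/

section Escape

open Metric Set Filter Topology

theorem normalSpace_of_isOpenMap_surjective {Z Y : Type*} [TopologicalSpace Z] [TopologicalSpace Y]
    [WeaklyLocallyCompactSpace Z] [SigmaCompactSpace Z] [T2Space Y] {q : Z → Y}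
    (hc : Continuous q) (ho : IsOpenMap q) (hs : Function.Surjective q) : NormalSpace Y := by
  have : SigmaCompactSpace Y := by
    rw [← isSigmaCompact_univ_iff, ← hs.range_eq]
    exact isSigmaCompact_range hc
  have : WeaklyLocallyCompactSpace Y := ⟨fun y => by
    obtain ⟨z, rfl⟩ := hs y
    obtain ⟨K, hK, hz⟩ := exists_compact_mem_nhds z
    exact ⟨q '' K, hK.image hc, ho.image_mem_nhds hz⟩⟩
  infer_instance

variable {X : Type*} [TopologicalSpace X] [T2Space X]
  {E : Type*} [NormedAddCommGroup E] [NormedSpace ℝ E] [FiniteDimensional ℝ E]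

/-- Following a path in `A` from a point of the open cell `C` to a point outside `C` up to the first
exit time gives, in the coordinates of `C`, an unbounded connected set close to `A \ C`. -/
theorem exists_unbounded_isPreconnected {j : E → X} (hj : IsOpenEmbedding j) {A N : Set X}
    (hA : IsPathConnected A) (hjA : range j ⊆ A) (hne : ¬ A ⊆ range j) (hN : IsOpen N)
    (hAN : A \ range j ⊆ N) :
    ∃ G : Set E, IsPreconnected G ∧ ¬ Bornology.IsBounded G ∧ ∀ x ∈ G, j x ∈ N := by
  obtain ⟨p, hpA, hpj⟩ := not_subset.1 hne
  have hjoin := hA.joinedIn (j 0) (hjA ⟨0, rfl⟩) p hpA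
  set γ := hjoin.somePath
  have hcomp : IsCompact {s | γ s ∉ range j} :=
    (hj.isOpen_range.isClosed_compl.preimage γ.continuous).isCompact
  obtain ⟨s, hs, hmin⟩ := hcomp.exists_isLeast ⟨1, by simpa using hpj⟩
  have hs0 : (0 : unitInterval) < s := by
    refine lt_of_le_of_ne unitInterval.nonneg' fun h => hs ?_
    rw [← h, γ.source]
    exact ⟨0, rfl⟩
  have hbefore : ∀ t < s, γ t ∈ range j := fun t ht => by
    by_contra h
    exact (hmin h).not_gt ht
  have hsN : γ s ∈ N := hAN ⟨hjoin.somePath_mem s, hs⟩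
  obtain ⟨l, hl, hlN⟩ := exists_Ioc_subset_of_mem_nhds
    ((hN.preimage γ.continuous).mem_nhds hsN) ⟨0, hs0⟩
  set J : Set unitInterval := Ioo l s
  have hJr : γ '' J ⊆ range j := by
    rintro _ ⟨t, ht, rfl⟩
    exact hbefore t ht.2
  have hJpre : IsPreconnected (γ '' J) := isPreconnected_Ioo.image _ γ.continuous.continuousOn
  refine ⟨j ⁻¹' (γ '' J), hJpre.preimage_of_isOpenMap hj.injective hj.isOpenMap hJr, ?_, ?_⟩
  · intro hb
    have hcl : IsClosed (j '' closure (j ⁻¹' (γ '' J))) :=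
      (hb.isCompact_closure.image hj.continuous).isClosed
    have hsub : γ '' J ⊆ j '' closure (j ⁻¹' (γ '' J)) := by
      intro x hx
      obtain ⟨e, rfl⟩ := hJr hx
      exact ⟨e, subset_closure hx, rfl⟩
    have hsJ : s ∈ closure J := by
      rw [closure_Ioo hl.ne]
      exact ⟨hl.le, le_rfl⟩
    have : γ s ∈ closure (γ '' J) := image_closure_subset_closure_image γ.continuous ⟨s, hsJ, rfl⟩
    obtain ⟨e, -, he⟩ := closure_minimal hsub hcl this
    exact hs ⟨e, he⟩
  · rintro x ⟨t, ht, htx⟩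
    rw [← htx]
    exact hlN ⟨ht.1, ht.2.le⟩

/-- If two open cells `A`, `B` meet in an open cell `C`, and neither is properly contained in the
other, then there is a chain of points in `C` that leaves every compact subset of `A` and every
compact subset of `B`; consecutive points are joined by paths that do so too. -/
theorem exists_escaping_chain (hE : 1 < Module.rank ℝ E) {jA jB j : E → X}
    (hA : IsOpenEmbedding jA) (hB : IsOpenEmbedding jB) (hj : IsOpenEmbedding j)
    (hABC : range jA ∩ range jB = range j) (h1 : ¬ range jA ⊂ range jB)
    (h2 : ¬ range jB ⊂ range jA) :
    ∃ (V : ℕ → Set X) (y : ℕ → X), (∀ k, IsOpen (V k)) ∧ (∀ k, V k ⊆ range j) ∧ Antitone V ∧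
      (∀ k, JoinedIn (V k) (y k) (y (k + 1))) ∧
      ∀ K, IsCompact K → K ⊆ range jA ∨ K ⊆ range jB → ∃ k, Disjoint K (V k) := by
  suffices h : ∃ f : E → ℝ, Continuous f ∧ ∃ ε : ℝ,
      (∀ K, IsCompact K → K ⊆ range jA ∨ K ⊆ range jB →
        Bornology.IsBounded (j ⁻¹' K ∩ {z | |f z| < ε})) ∧
      ∃ y : ℕ → E, ∀ k : ℕ, JoinedIn {z | |f z| < ε ∧ k < ‖z‖} (y k) (y (k + 1)) by
    obtain ⟨f, hf, ε, hbd, y, hy⟩ := h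
    refine ⟨fun k => j '' {z | |f z| < ε ∧ k < ‖z‖}, fun k => j (y k), fun k => ?_, fun k => ?_,
      ?_, fun k => (hy k).map hj.continuous, fun K hK hKAB => ?_⟩
    · exact hj.isOpenMap _ ((isOpen_lt hf.abs continuous_const).inter
        (isOpen_lt continuous_const continuous_norm))
    · exact image_subset_range _ _
    · refine antitone_nat_of_succ_le fun k => image_mono fun z hz => ⟨hz.1, ?_⟩
      have := hz.2
      push_cast at this
      linarith
    · obtain ⟨R, hR⟩ := isBounded_iff_forall_norm_le.1 (hbd K hK hKAB)
      obtain ⟨k, hk⟩ := exists_nat_ge R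
      refine ⟨k, Set.disjoint_left.2 ?_⟩
      rintro _ hxK ⟨z, ⟨hz1, hz2⟩, rfl⟩
      exact absurd (hR z ⟨hxK, hz1⟩) (by linarith)
  have hjA : range j ⊆ range jA := hABC ▸ inter_subset_left
  have hjB : range j ⊆ range jB := hABC ▸ inter_subset_right
  by_cases hAB : range jA = range jB
  · have hAC : range jA = range j := by rw [← hABC, ← hAB, inter_self]
    have hBC : range jB = range j := by rw [← hABC, ← hAB, inter_self, hAB]
    have : Nontrivial E := rank_pos_iff_nontrivial.1 (zero_lt_one.trans hE)
    obtain ⟨v, hv⟩ := exists_norm_eq E (zero_le_one' ℝ)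
    refine ⟨fun _ => 0, continuous_const, 1, fun K hK hKAB => ?_, fun k => ((k : ℝ) + 1) • v,
      fun k => ?_⟩
    · rw [hAC, hBC, or_self] at hKAB
      exact ((hj.isInducing.isCompact_preimage_iff hKAB).2 hK).isBounded.subset inter_subset_left
    · refine JoinedIn.ofLine (f := fun t : ℝ => ((k : ℝ) + 1 + t) • v) (by fun_prop) (by simp)
        (by push_cast; rfl) ?_
      rintro _ ⟨t, ht, rfl⟩
      have ht0 := ht.1
      have hk : (0 : ℝ) ≤ k := k.cast_nonneg
      refine ⟨by simp, ?_⟩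
      rw [norm_smul, hv, mul_one, Real.norm_of_nonneg (by linarith)]
      linarith
  -- otherwise `A \ C` and `B \ C` are both nonempty
  have hAne : ¬ range jA ⊆ range j := fun h =>
    h1 ((h.trans hjB).ssubset_of_ne hAB)
  have hBne : ¬ range jB ⊆ range j := fun h =>
    h2 ((h.trans hjA).ssubset_of_ne (Ne.symm hAB))
  set Y : Set X := range jA ∪ range jB with hY
  have hYo : IsOpen Y := hA.isOpen_range.union hB.isOpen_range
  have hnormal : NormalSpace Y := by
    have : WeaklyLocallyCompactSpace (E ⊕ E) := by
      constructor
      rintro (x | x)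
      · exact ⟨_, (isCompact_closedBall x 1).image continuous_inl,
          isOpenMap_inl.image_mem_nhds (closedBall_mem_nhds x one_pos)⟩
      · exact ⟨_, (isCompact_closedBall x 1).image continuous_inr,
          isOpenMap_inr.image_mem_nhds (closedBall_mem_nhds x one_pos)⟩
    refine normalSpace_of_isOpenMap_surjective (Z := E ⊕ E) (Y := Y)
      (q := Sum.elim (fun x => ⟨jA x, Or.inl ⟨x, rfl⟩⟩) (fun x => ⟨jB x, Or.inr ⟨x, rfl⟩⟩)) ?_ ?_ ?_
    · exact (hA.continuous.subtype_mk _).sumElim (hB.continuous.subtype_mk _)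
    · refine IsOpenMap.sumElim ?_ ?_
      · exact hA.isOpenMap.codRestrict _
      · exact hB.isOpenMap.codRestrict _
    · rintro ⟨_, ⟨x, rfl⟩ | ⟨x, rfl⟩⟩
      · exact ⟨Sum.inl x, rfl⟩
      · exact ⟨Sum.inr x, rfl⟩
  have hPc : IsClosed {y : Y | (y : X) ∉ range jB} :=
    hB.isOpen_range.isClosed_compl.preimage continuous_subtype_val
  have hQc : IsClosed {y : Y | (y : X) ∉ range jA} :=
    hA.isOpen_range.isClosed_compl.preimage continuous_subtype_val
  obtain ⟨φ, hφ0, hφ1, -⟩ := exists_continuous_zero_one_of_isClosed hPc hQc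
    (Set.disjoint_left.2 fun y hy hy' => y.2.elim hy' hy)
  have hjY : ∀ x, j x ∈ Y := fun x => Or.inl (hjA ⟨x, rfl⟩)
  set f : E → ℝ := fun x => φ ⟨j x, hjY x⟩ - 1 / 2 with hf
  have hfc : Continuous f := (φ.continuous.comp (hj.continuous.subtype_mk _)).sub continuous_const
  have hpc : ∀ {i : E → X}, Continuous i → IsPathConnected (range i) := fun hi =>
    isPathConnected_range hi
  obtain ⟨G, hG, hGu, hGN⟩ := exists_unbounded_isPreconnected hj (hpc hA.continuous) hjA hAne
    (N := Subtype.val '' {y : Y | φ y < 1 / 2})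
    (hYo.isOpenMap_subtype_val _ (isOpen_lt φ.continuous continuous_const)) (by
      rintro x ⟨hxA, hxj⟩
      refine ⟨⟨x, Or.inl hxA⟩, ?_, rfl⟩
      have : φ ⟨x, Or.inl hxA⟩ = 0 := hφ0 fun hxB => hxj (hABC ▸ ⟨hxA, hxB⟩)
      simp [this])
  obtain ⟨H, hH, hHu, hHN⟩ := exists_unbounded_isPreconnected hj (hpc hB.continuous) hjB hBne
    (N := Subtype.val '' {y : Y | 1 / 2 < φ y})
    (hYo.isOpenMap_subtype_val _ (isOpen_lt continuous_const φ.continuous)) (by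
      rintro x ⟨hxB, hxj⟩
      refine ⟨⟨x, Or.inr hxB⟩, ?_, rfl⟩
      have : φ ⟨x, Or.inr hxB⟩ = 1 := hφ1 fun hxA => hxj (hABC ▸ ⟨hxA, hxB⟩)
      rw [mem_ofPred_eq, this]
      norm_num)
  refine ⟨f, hfc, 1 / 4, fun K hK hKAB => ?_, exists_joinedIn_sequence hE hfc hG hH ?_ ?_ hGu hHu
    (by norm_num)⟩
  · have hKY : K ⊆ range (Subtype.val : Y → X) := by
      rw [Subtype.range_coe]
      exact hKAB.elim (fun h => h.trans subset_union_left) fun h => h.trans subset_union_right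
    have hK' : IsCompact ((Subtype.val : Y → X) ⁻¹' K) :=
      (IsInducing.subtypeVal.isCompact_preimage_iff hKY).2 hK
    have hL : IsCompact (((Subtype.val : Y → X) ⁻¹' K) ∩ {y | |φ y - 1 / 2| ≤ 1 / 4}) :=
      hK'.inter_right (isClosed_le (by fun_prop) continuous_const)
    -- where `φ` is close to `1 / 2` one is in `C`
    have hLj : Subtype.val '' (((Subtype.val : Y → X) ⁻¹' K) ∩ {y | |φ y - 1 / 2| ≤ 1 / 4}) ⊆ range
        j := by
      rintro _ ⟨y, ⟨-, hy⟩, rfl⟩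
      rw [← hABC]
      constructor
      · by_contra h
        have : φ y = 1 := hφ1 h
        norm_num [this, abs_of_pos] at hy
      · by_contra h
        have : φ y = 0 := hφ0 h
        norm_num [this, abs_of_pos] at hy
    refine ((hj.isInducing.isCompact_preimage_iff hLj).2
      (hL.image continuous_subtype_val)).isBounded.subset ?_
    rintro x ⟨hxK, hx : |f x| < 1 / 4⟩
    exact ⟨⟨j x, hjY x⟩, ⟨hxK, hx.le⟩, rfl⟩
  · intro x hx
    obtain ⟨y, hy, hyx⟩ := hGN x hx
    have : y = ⟨j x, hjY x⟩ := Subtype.ext hyx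
    rw [this] at hy
    exact sub_neg.2 hy
  · intro x hx
    obtain ⟨y, hy, hyx⟩ := hHN x hx
    have : y = ⟨j x, hjY x⟩ := Subtype.ext hyx
    rw [this] at hy
    exact sub_pos.2 hy

end Escape

/-! ### Segments in charts -/

section Segments

open Metric Set Filter Topology

variable {E H M : Type*} [NormedAddCommGroup E] [NormedSpace ℝ E] [TopologicalSpace H]
  (I : ModelWithCorners ℝ E H) [TopologicalSpace M] [ChartedSpace H M]

/-- `σ`, restricted to `[0, 1]`, is an embedded straight segment in some chart of the atlas. -/
def IsChartSegment (σ : ℝ → M) : Prop :=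
  ContinuousOn σ (Icc 0 1) ∧ ∃ e ∈ atlas H M, ∃ v : E, v ≠ 0 ∧ ∀ s ∈ Icc (0 : ℝ) 1,
    σ s ∈ e.source ∧ e.extend I (σ s) = e.extend I (σ 0) + s • v

/-- The points `x` and `y` are the ends of a chart segment contained in `V`. -/
def SegmentJoined (V : Set M) (x y : M) : Prop :=
  ∃ σ : ℝ → M, IsChartSegment I σ ∧ σ 0 = x ∧ σ 1 = y ∧ ∀ s ∈ Icc (0 : ℝ) 1, σ s ∈ V

variable {I}

theorem IsChartSegment.injOn {σ : ℝ → M} (h : IsChartSegment I σ) : InjOn σ (Icc 0 1) := by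
  obtain ⟨-, e, -, v, hv, hσ⟩ := h
  intro s hs t ht hst
  have h1 := (hσ s hs).2
  rw [hst, (hσ t ht).2] at h1
  exact (smul_left_injective ℝ hv (add_left_cancel h1)).symm

theorem SegmentJoined.symm {V : Set M} {x y : M} (h : SegmentJoined I V x y) :
    SegmentJoined I V y x := by
  obtain ⟨σ, ⟨hc, e, he, v, hv, hσ⟩, h0, h1, hV⟩ := h
  have hmaps : MapsTo (fun s : ℝ => 1 - s) (Icc 0 1) (Icc 0 1) := fun s hs =>
    ⟨by linarith [hs.2], by linarith [hs.1]⟩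
  refine ⟨fun s => σ (1 - s), ⟨hc.comp (by fun_prop) hmaps, e, he, -v, neg_ne_zero.2 hv,
    fun s hs => ⟨(hσ _ (hmaps hs)).1, ?_⟩⟩, by simpa using h1, by simpa using h0,
    fun s hs => hV _ (hmaps hs)⟩
  simp only [(hσ _ (hmaps hs)).2, sub_zero, (hσ 1 ⟨zero_le_one, le_rfl⟩).2]
  module

/-- Around a point at which the chart covers a full neighbourhood in the model vector space, any two
points are joined by a chart segment. -/
theorem exists_nhds_segmentJoined {e : OpenPartialHomeomorph M H} (he : e ∈ atlas H M) {V : Set M}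
    (hV : IsOpen V) {x : M} (hxV : x ∈ V) (hx : x ∈ e.source)
    (hint : (e.extend I).target ∈ 𝓝 (e.extend I x)) :
    ∃ ρ > 0, ball (e.extend I x) ρ ⊆ (e.extend I).target ∧
      ∀ a ∈ ball (e.extend I x) ρ, ∀ b ∈ ball (e.extend I x) ρ, a ≠ b →
        SegmentJoined I V ((e.extend I).symm a) ((e.extend I).symm b) := by
  have hxs : x ∈ (e.extend I).source := by rwa [e.extend_source]
  have hsymm : (e.extend I).symm (e.extend I x) = x := (e.extend I).left_inv hxs
  have hcont : ContinuousAt (e.extend I).symm (e.extend I x) := e.continuousAt_extend_symm hx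
  have hVpre : (e.extend I).symm ⁻¹' V ∈ 𝓝 (e.extend I x) :=
    hcont.preimage_mem_nhds (hsymm.symm ▸ hV.mem_nhds hxV)
  obtain ⟨ρ, hρ, hball⟩ := Metric.mem_nhds_iff.1 (inter_mem hint hVpre)
  refine ⟨ρ, hρ, fun a ha => (hball ha).1, fun a ha b hb hab => ?_⟩
  have hmem : ∀ s ∈ Icc (0 : ℝ) 1, a + s • (b - a) ∈ ball (e.extend I x) ρ := fun s hs =>
    (convex_ball _ _).add_smul_sub_mem ha hb hs
  refine ⟨fun s => (e.extend I).symm (a + s • (b - a)), ⟨?_, e, he, b - a,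
    sub_ne_zero.2 hab.symm, fun s hs => ⟨?_, ?_⟩⟩, by simp, by simp, fun s hs =>
        (hball (hmem s hs)).2⟩
  · exact (e.continuousOn_extend_symm (I := I)).comp (by fun_prop) fun s hs => (hball (hmem s hs)).1
  · rw [← e.extend_source (I := I)]
    exact (e.extend I).map_target (hball (hmem s hs)).1
  · have h0 := hmem 0 ⟨le_rfl, zero_le_one⟩
    rw [(e.extend I).right_inv (hball (hmem s hs)).1, (e.extend I).right_inv (hball h0).1]
    simp

/-- In an open set of interior points, paths can be replaced by nonempty chains of chart segments.
-/
theorem JoinedIn.transGen_segmentJoined [Nontrivial E] {V : Set M} (hV : IsOpen V)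
    (hint : ∀ x ∈ V, ∃ e ∈ atlas H M, x ∈ e.source ∧ (e.extend I).target ∈ 𝓝 (e.extend I x))
    {x y : M} (h : JoinedIn V x y) : Relation.TransGen (SegmentJoined I V) x y := by
  have hpre : IsPreconnected (range h.somePath) := isPreconnected_range h.somePath.continuous
  have hsub : range h.somePath ⊆ V := by
    rintro _ ⟨t, rfl⟩
    exact h.somePath_mem t
  refine hpre.induction₂ (fun a b => Relation.TransGen (SegmentJoined I V) a b) ?_ ?_ ?_
    ⟨0, h.somePath.source⟩ ⟨1, h.somePath.target⟩
  · intro a ha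
    refine Filter.Eventually.filter_mono nhdsWithin_le_nhds ?_
    obtain ⟨e, he, hae, hat⟩ := hint a (hsub ha)
    obtain ⟨ρ, hρ, hρt, hseg⟩ := exists_nhds_segmentJoined he hV (hsub ha) hae hat
    have hsymm : (e.extend I).symm (e.extend I a) = a := (e.extend I).left_inv
        (by rwa [e.extend_source])
    have hself := mem_ball_self (x := e.extend I a) hρ
    filter_upwards [e.extend_source_mem_nhds (I := I) hae,
      (e.continuousAt_extend (I := I) hae).preimage_mem_nhds (ball_mem_nhds _ hρ)] with b hb hbρ
    have hbsymm : (e.extend I).symm (e.extend I b) = b := (e.extend I).left_inv hb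
    by_cases hab : e.extend I a = e.extend I b
    · have hab' : b = a := by rw [← hsymm, ← hbsymm, hab]
      rw [hab']
      -- go to a nearby point and back
      obtain ⟨v, hv⟩ := exists_ne (0 : E)
      have hvn : 0 < ‖v‖ := norm_pos_iff.2 hv
      have hc : e.extend I a + (ρ / 2 / ‖v‖) • v ∈ ball (e.extend I a) ρ := by
        rw [mem_ball, dist_eq_norm, add_sub_cancel_left, norm_smul, Real.norm_of_nonneg
            (by positivity),
          div_mul_cancel₀ _ hvn.ne']
        linarith
      have h1 := hseg _ hself _ hc (by
        intro h
        have := left_eq_add.1 h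
        rw [smul_eq_zero] at this
        exact this.elim (by positivity) hv)
      rw [hsymm] at h1
      exact (Relation.TransGen.single h1).tail h1.symm
    · have h1 := hseg _ hself _ hbρ hab
      rw [hsymm, hbsymm] at h1
      exact Relation.TransGen.single h1
  · intro a b c _ _ _ hab hbc
    exact hab.trans hbc
  · intro a b _ _ hab
    have : Std.Symm (SegmentJoined I V) := ⟨fun _ _ => SegmentJoined.symm⟩
    exact Std.Symm.symm _ _ hab

/-- Infinitely many finite chains, each beginning where the previous one ends, form one infinite
chain. -/
theorem exists_infinite_chain {X : Type*} {R : ℕ → X → X → Prop} {y : ℕ → X}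
    (h : ∀ k, Relation.TransGen (R k) (y k) (y (k + 1))) :
    ∃ (z : ℕ → X) (κ : ℕ → ℕ), (∀ i, R (κ i) (z i) (z (i + 1))) ∧ Tendsto κ atTop atTop := by
  -- `Q k m x`: there is a chain of `m + 1` steps from `x` to `y (k + 1)`
  let Q : ℕ → ℕ → X → Prop := fun k m => Nat.rec (fun x => R k x (y (k + 1)))
    (fun _ q x => ∃ x', R k x x' ∧ q x') m
  have hQ : ∀ k x, Relation.TransGen (R k) x (y (k + 1)) → ∃ m, Q k m x := by
    intro k x hx
    induction hx using Relation.TransGen.head_induction_on with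
    | single h => exact ⟨0, h⟩
    | head h _ ih =>
      obtain ⟨m, hm⟩ := ih
      exact ⟨m + 1, _, h, hm⟩
  have hstep : ∀ s : {s : ℕ × ℕ × X // Q s.1 s.2.1 s.2.2}, ∃ s' :
      {s : ℕ × ℕ × X // Q s.1 s.2.1 s.2.2},
      R s.1.1 s.1.2.2 s'.1.2.2 ∧ ((s'.1.1 = s.1.1 ∧ s.1.2.1 = s'.1.2.1 + 1) ∨ s'.1.1 = s.1.1 + 1)
          := by
    rintro ⟨⟨k, m, x⟩, hs⟩
    cases m with
    | zero =>
      obtain ⟨m, hm⟩ := hQ (k + 1) _ (h (k + 1))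
      exact ⟨⟨⟨k + 1, m, y (k + 1)⟩, hm⟩, hs, Or.inr rfl⟩
    | succ m =>
      obtain ⟨x', hx', hq⟩ := hs
      exact ⟨⟨⟨k, m, x'⟩, hq⟩, hx', Or.inl ⟨rfl, rfl⟩⟩
  choose next hnext using hstep
  obtain ⟨m₀, hm₀⟩ := hQ 0 _ (h 0)
  let S : ℕ → {s : ℕ × ℕ × X // Q s.1 s.2.1 s.2.2} := fun i => next^[i] ⟨⟨0, m₀, y 0⟩, hm₀⟩
  have hS : ∀ i, S (i + 1) = next (S i) := fun i => Function.iterate_succ_apply' _ _ _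
  refine ⟨fun i => (S i).1.2.2, fun i => (S i).1.1, fun i => ?_, ?_⟩
  · simp only [hS]
    exact (hnext (S i)).1
  · have hmono : Monotone fun i => (S i).1.1 := by
      refine monotone_nat_of_le_succ fun i => ?_
      rw [hS]
      rcases (hnext (S i)).2 with h | h
      · exact h.1.ge
      · rw [h]
        exact Nat.le_succ _
    have hgrow : ∀ m i, (S i).1.2.1 = m → ∃ i', (S i').1.1 = (S i).1.1 + 1 := by
      intro m
      induction m with
      | zero =>
        intro i hi
        rcases (hnext (S i)).2 with h | h
        · omega
        · exact ⟨i + 1, by rw [hS, h]⟩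
      | succ m ih =>
        intro i hi
        rcases (hnext (S i)).2 with h | h
        · obtain ⟨i', hi'⟩ := ih (i + 1) (by rw [hS]; omega)
          exact ⟨i', by rw [hi', hS, h.1]⟩
        · exact ⟨i + 1, by rw [hS, h]⟩
    refine tendsto_atTop_atTop_of_monotone hmono fun b => ?_
    induction b with
    | zero => exact ⟨0, Nat.zero_le _⟩
    | succ b ih =>
      obtain ⟨i, hi⟩ := ih
      obtain ⟨i', hi'⟩ := hgrow _ i rfl
      exact ⟨i', by omega⟩

end Segments

/-! ### Loop erasure and piecewise linear curves -/

section LoopErasure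

open Set Filter Topology

variable {X : Type*}

/-- The concatenation of infinitely many paths, the `i`-th one being run through on `[i, i + 1]`. -/
noncomputable def concat (τ : ℕ → ℝ → X) (t : ℝ≥0) : X := τ ⌊t⌋₊ (t - ⌊t⌋₊)

theorem concat_apply {τ : ℕ → ℝ → X} (hτ : ∀ i, τ i 1 = τ (i + 1) 0) {i : ℕ} {t : ℝ≥0}
    (h0 : (i : ℝ≥0) ≤ t) (h1 : t ≤ i + 1) : concat τ t = τ i (t - i) := by
  rcases h1.lt_or_eq with h | rfl
  · have : ⌊t⌋₊ = i := (Nat.floor_eq_iff zero_le).2 ⟨h0, h⟩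
    rw [concat, this]
  · have : ⌊(i : ℝ≥0) + 1⌋₊ = i + 1 := by exact_mod_cast Nat.floor_natCast (R := ℝ≥0) (i + 1)
    rw [concat, this]
    push_cast
    rw [sub_self, add_sub_cancel_left, hτ]

theorem concat_injective {τ : ℕ → ℝ → X} (hτ : ∀ i, InjOn (τ i) (Icc 0 1))
    (hne : ∀ i k, i < k → ∀ u ∈ Ico (0 : ℝ) 1, ∀ w ∈ Icc (0 : ℝ) 1, τ i u ≠ τ k w) :
    Function.Injective (concat τ) := by
  have hfr : ∀ t : ℝ≥0, (t : ℝ) - ⌊t⌋₊ ∈ Ico (0 : ℝ) 1 := by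
    intro t
    have h0 : ((⌊t⌋₊ : ℕ) : ℝ) ≤ t := by exact_mod_cast Nat.floor_le zero_le
    have h1 : (t : ℝ) < (⌊t⌋₊ : ℕ) + 1 := by exact_mod_cast Nat.lt_floor_add_one t
    exact ⟨by linarith, by linarith⟩
  intro s t hst
  rcases lt_trichotomy ⌊s⌋₊ ⌊t⌋₊ with h | h | h
  · exact absurd hst (hne _ _ h _ (hfr s) _ (Ico_subset_Icc_self (hfr t)))
  · unfold concat at hst
    have ht := hfr t
    rw [← h] at ht hst
    have := hτ _ (Ico_subset_Icc_self (hfr s)) (Ico_subset_Icc_self ht) hst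
    exact NNReal.coe_injective (sub_left_injective this)
  · exact absurd hst.symm (hne _ _ h _ (hfr t) _ (Ico_subset_Icc_self (hfr s)))

variable [TopologicalSpace X]

theorem continuous_concat {τ : ℕ → ℝ → X} (hτ : ∀ i, τ i 1 = τ (i + 1) 0)
    (hc : ∀ i, ContinuousOn (τ i) (Icc 0 1)) : Continuous (concat τ) := by
  have hlf : LocallyFinite fun i : ℕ => Icc (i : ℝ≥0) (i + 1) := by
    intro t
    refine ⟨Iio (t + 1), Iio_mem_nhds (lt_add_one t), (finite_Iic ⌈t + 1⌉₊).subset ?_⟩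
    rintro i ⟨x, hx, hxt⟩
    exact Nat.cast_le.1 ((hx.1.trans (le_of_lt hxt)).trans (Nat.le_ceil (t + 1)))
  refine hlf.continuous ?_ (fun i => isClosed_Icc) fun i => ?_
  · refine eq_univ_of_forall fun t => mem_iUnion.2 ⟨⌊t⌋₊, Nat.floor_le zero_le, ?_⟩
    exact (Nat.lt_floor_add_one t).le
  · refine ContinuousOn.congr (f := fun t : ℝ≥0 => τ i (t - i)) ?_ fun t ht => concat_apply hτ ht.1
      ht.2
    refine (hc i).comp (by fun_prop) fun t ht => ?_
    have h0 : (i : ℝ) ≤ t := by exact_mod_cast ht.1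
    have h1 : (t : ℝ) ≤ i + 1 := by exact_mod_cast ht.2
    exact ⟨by linarith, by linarith⟩

/-- Loop erasure for a locally finite infinite chain of arcs: from the current arc, move on along
the last arc that meets it, at the first point of meeting. The pieces `σ (J i)`, restricted to `[a
i, b i]`, then meet only at consecutive end points. -/
theorem exists_loop_erasure [T2Space X] {σ : ℕ → ℝ → X} (hc : ∀ i, ContinuousOn (σ i) (Icc 0 1))
    (hσ : ∀ i, σ i 1 = σ (i + 1) 0)
    (hfin : ∀ i, ∃ N, ∀ k ≥ N, Disjoint (σ i '' Icc 0 1) (σ k '' Icc 0 1)) :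
    ∃ (J : ℕ → ℕ) (a b : ℕ → ℝ), StrictMono J ∧ ∀ i, 0 ≤ a i ∧ a i < b i ∧ b i ≤ 1 ∧
      σ (J i) (b i) = σ (J (i + 1)) (a (i + 1)) ∧
      (∀ t ∈ Ico (a i) (b i), σ (J i) t ∉ σ (J (i + 1)) '' Icc 0 1) ∧
      ∀ t ∈ Icc (a i) (b i), ∀ k > J (i + 1), σ (J i) t ∉ σ k '' Icc 0 1 := by
  have h01 : (1 : ℝ) ∈ Icc (0 : ℝ) 1 := ⟨zero_le_one, le_rfl⟩
  have h00 : (0 : ℝ) ∈ Icc (0 : ℝ) 1 := ⟨le_rfl, zero_le_one⟩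
  set L : ℕ → Set X := fun i => σ i '' Icc 0 1 with hL
  have hLc : ∀ i, IsClosed (L i) := fun i => (isCompact_Icc.image_of_continuousOn (hc i)).isClosed
  have hone : ∀ i, σ i 1 ∈ L (i + 1) := fun i => ⟨0, h00, (hσ i).symm⟩
  have hbdd : ∀ i (s : Set ℝ) , s ⊆ Icc 0 1 → BddAbove {k | ∃ t ∈ s, σ i t ∈ L k} := by
    intro i s hs
    obtain ⟨N, hN⟩ := hfin i
    refine ⟨N, ?_⟩
    rintro k ⟨t, ht, htk⟩
    by_contra! h
    exact Set.disjoint_left.1 (hN k h.le) ⟨t, hs ht, rfl⟩ htk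
  -- a position on the arc `σ p.1` at a point that no later arc meets
  let P : Type := {p : ℕ × ℝ // p.2 ∈ Icc (0 : ℝ) 1 ∧ ∀ k > p.1, σ p.1 p.2 ∉ L k}
  have hstep : ∀ p : P, ∃ (q : P) (b : ℝ), p.1.1 < q.1.1 ∧ p.1.2 < b ∧ b ≤ 1 ∧
      σ p.1.1 b = σ q.1.1 q.1.2 ∧ (∀ t ∈ Ico p.1.2 b, σ p.1.1 t ∉ L q.1.1) ∧
      ∀ t ∈ Icc p.1.2 b, ∀ k > q.1.1, σ p.1.1 t ∉ L k := by
    rintro ⟨⟨i, s⟩, hs, hsk⟩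
    have hsub : Icc s 1 ⊆ Icc 0 1 := Icc_subset_Icc_left hs.1
    set T := {k | ∃ t ∈ Icc s 1, σ i t ∈ L k} with hT
    have hTb : BddAbove T := hbdd i _ hsub
    have hTmem : i + 1 ∈ T := ⟨1, ⟨hs.2, le_rfl⟩, hone i⟩
    obtain ⟨t₀, ht₀, hLt₀⟩ := Nat.sSup_mem ⟨_, hTmem⟩ hTb
    set k := sSup T with hk
    have hik : i < k := Nat.lt_of_succ_le (le_csSup hTb hTmem)
    have hcomp : IsCompact (Icc s 1 ∩ σ i ⁻¹' L k) :=
      isCompact_Icc.of_isClosed_subset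
        (((hc i).mono hsub).preimage_isClosed_of_isClosed isClosed_Icc (hLc k)) inter_subset_left
    obtain ⟨b, ⟨hb, hbk⟩, hmin⟩ := hcomp.exists_isLeast ⟨t₀, ht₀, hLt₀⟩
    obtain ⟨s', hs', hs'b⟩ := hbk
    have hnot : ∀ t ∈ Icc s 1, ∀ m > k, σ i t ∉ L m := fun t ht m hm h =>
      hm.not_ge (le_csSup hTb ⟨t, ht, h⟩)
    refine ⟨⟨⟨k, s'⟩, hs', fun m hm => ?_⟩, b, hik, ?_, hb.2, hs'b.symm, ?_, ?_⟩
    · simp only [hs'b]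
      exact hnot b hb m hm
    · refine lt_of_le_of_ne hb.1 fun h => hsk k hik ?_
      simp only at h
      exact ⟨s', hs', by simp only [hs'b, h]⟩
    · intro t ht h
      exact (hmin ⟨⟨ht.1, ht.2.le.trans hb.2⟩, h⟩).not_gt ht.2
    · intro t ht m hm
      exact hnot t ⟨ht.1, ht.2.trans hb.2⟩ m hm
  choose next β hnext using hstep
  obtain ⟨p₀⟩ : Nonempty P := by
    have hb := hbdd 0 {0} (singleton_subset_iff.2 h00)
    obtain ⟨t, ht, s, hs, hst⟩ := Nat.sSup_mem (s := {k | ∃ t ∈ ({0} : Set ℝ), σ 0 t ∈ L k})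
      ⟨0, 0, rfl, mem_image_of_mem (σ 0) h00⟩ hb
    rw [mem_singleton_iff] at ht
    subst ht
    refine ⟨⟨(sSup {k | ∃ t ∈ ({0} : Set ℝ), σ 0 t ∈ L k}, s), hs, fun k hk h => ?_⟩⟩
    simp only [hst] at h
    exact (hk : _ < k).not_ge (le_csSup hb ⟨0, rfl, h⟩)
  let S : ℕ → P := fun i => next^[i] p₀
  have hS : ∀ i, S (i + 1) = next (S i) := fun i => Function.iterate_succ_apply' _ _ _
  refine ⟨fun i => (S i).1.1, fun i => (S i).1.2, fun i => β (S i), ?_, fun i => ?_⟩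
  · refine strictMono_nat_of_lt_succ fun i => ?_
    rw [hS]
    exact (hnext (S i)).1
  · obtain ⟨-, h1, h2, h3, h4, h5⟩ := hnext (S i)
    simp only [hS]
    exact ⟨(S i).2.1.1, h1, h2, h3, h4, h5⟩

end LoopErasure

section PiecewiseLinear

open Set Filter Topology

/-- A piecewise linear map is affine on a short initial piece of every segment in its domain. -/
theorem IsPLOn.exists_affine_on_ray {E F : Type*} [NormedAddCommGroup E] [NormedSpace ℝ E]
    [NormedAddCommGroup F] [NormedSpace ℝ F] {f : E → F} {D : Set E} (hf : IsPLOn f D) {x v : E}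
    (hx : x ∈ D) (hD : ∀ᶠ h in 𝓝[>] (0 : ℝ), x + h • v ∈ D) :
    ∃ ε > 0, ∃ w : F, ∀ h ∈ Ico (0 : ℝ) ε, f (x + h • v) = f x + h • w := by
  obtain ⟨K, hK, hP⟩ := hf x hx
  have hlim : Tendsto (fun h : ℝ => x + h • v) (𝓝[>] 0) (𝓝 x) := by
    have : Continuous fun h : ℝ => x + h • v := by fun_prop
    simpa using this.tendsto' 0 x (by simp) |>.mono_left (nhdsWithin_le_nhds (s := Ioi 0))
  have hev : ∀ᶠ h in 𝓝[>] (0 : ℝ), x + h • v ∈ ⋃ P ∈ K, P :=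
    (tendsto_nhdsWithin_iff.2 ⟨hlim, hD⟩).eventually hK
  obtain ⟨P, hPK, hfreq⟩ : ∃ P ∈ K, ∃ᶠ h in 𝓝[>] (0 : ℝ), x + h • v ∈ P := by
    by_contra! hcon
    have h1 : ∀ᶠ h in 𝓝[>] (0 : ℝ), ∀ P ∈ K, x + h • v ∉ P :=
      (Filter.eventually_all_finset K).2 fun P hPK => hcon P hPK
    obtain ⟨h, h2, h3⟩ := (hev.and h1).exists
    obtain ⟨P, hPK, hmem⟩ := mem_iUnion₂.1 h2
    exact h3 P hPK hmem
  obtain ⟨-, ⟨V, hV, rfl⟩, A, hA⟩ := hP P hPK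
  have hxP : x ∈ convexHull ℝ V :=
    (hV.isCompact_convexHull ℝ).isClosed.mem_of_frequently_of_tendsto hfreq hlim
  obtain ⟨ε, hεP, hε⟩ := (hfreq.and_eventually self_mem_nhdsWithin).exists
  have hε : 0 < ε := hε
  refine ⟨ε, hε, A.linear v, fun h hh => ?_⟩
  have hmem : x + h • v ∈ convexHull ℝ V := by
    have := (convex_convexHull ℝ V).add_smul_sub_mem hxP hεP (t := h / ε)
      ⟨div_nonneg hh.1 hε.le, (div_le_one hε).2 hh.2.le⟩
    rwa [add_sub_cancel_left, smul_smul, div_mul_cancel₀ _ hε.ne'] at this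
  rw [hA hmem, hA hxP, add_comm x, ← vadd_eq_add, AffineMap.map_vadd, vadd_eq_add, map_smul,
      add_comm]

variable {E H M : Type*} [NormedAddCommGroup E] [NormedSpace ℝ E] [TopologicalSpace H]
  {I : ModelWithCorners ℝ E H} [TopologicalSpace M] [ChartedSpace H M]

/-- On a piecewise linear manifold it suffices to check that a curve is affine before and after each
parameter in possibly different charts. -/
theorem IsPLManifold.isPLCurve (hM : IsPLManifold I M) {r : ℝ≥0 → M} (hr : Continuous r)
    (hright : ∀ t : ℝ≥0, ∃ e ∈ atlas H M, ∃ ε > (0 : ℝ), ∃ v : E, ∀ s : ℝ≥0, t ≤ s → (s : ℝ) - t <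
        ε →
      r s ∈ e.source ∧ e.extend I (r s) = e.extend I (r t) + ((s : ℝ) - t) • v)
    (hleft : ∀ t : ℝ≥0, ∃ e ∈ atlas H M, ∃ ε > (0 : ℝ), ∃ v : E, ∀ s : ℝ≥0, s ≤ t → (t : ℝ) - s < ε
        →
      r s ∈ e.source ∧ e.extend I (r s) = e.extend I (r t) + ((s : ℝ) - t) • v) :
    IsPLCurve I r := by
  intro t
  obtain ⟨e, he, ε, hε, v, hv⟩ := hright t
  obtain ⟨e', he', ε', hε', v', hv'⟩ := hleft t
  have hte : r t ∈ e.source := (hv t le_rfl (by simpa using hε)).1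
  have hte' : r t ∈ e'.source := (hv' t le_rfl (by simpa using hε')).1
  obtain ⟨δ, hδ, hδe⟩ := Metric.eventually_nhds_iff.1
    ((hr.tendsto t).eventually (e.open_source.mem_nhds hte))
  have hδe' : ∀ s : ℝ≥0, |(s : ℝ) - t| < δ → r s ∈ e.source := fun s hs => hδe
      (by rwa [NNReal.dist_eq])
  -- the part of the curve before `t`, seen in the chart `e`
  obtain ⟨η, hη, w, hw⟩ : ∃ η > (0 : ℝ), ∃ w : E, ∀ s : ℝ≥0, s ≤ t → (t : ℝ) - s < η →
      e.extend I (r s) = e.extend I (r t) + ((s : ℝ) - t) • w := by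
    rcases eq_or_lt_of_le (zero_le : 0 ≤ t) with h0 | ht0
    · refine ⟨1, one_pos, 0, fun s hs _ => ?_⟩
      have : s = t := le_antisymm hs (h0.symm.le.trans zero_le)
      simp [this]
    have hmem : ∀ s : ℝ≥0, r s ∈ e.source → r s ∈ e'.source →
        e'.extend I (r s) ∈ ((e'.extend I).symm.trans (e.extend I)).source := by
      intro s hs hs'
      have hs'' : r s ∈ (e'.extend I).source := by rwa [e'.extend_source]
      rw [PartialEquiv.trans_source, PartialEquiv.symm_source]
      refine ⟨(e'.extend I).map_source hs'', ?_⟩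
      rw [mem_preimage, (e'.extend I).left_inv hs'', e.extend_source]
      exact hs
    set μ := min (min ε' δ) t with hμ
    have hμ0 : 0 < μ := lt_min (lt_min hε' hδ) ht0
    have key : ∀ h ∈ Ico (0 : ℝ) μ, ∃ s : ℝ≥0, (s : ℝ) = t - h ∧ s ≤ t ∧ r s ∈ e.source ∧ r s ∈
        e'.source ∧
        e'.extend I (r s) = e'.extend I (r t) + h • (-v') := by
      intro h hh
      have h1 : h < ε' := hh.2.trans_le ((min_le_left _ _).trans (min_le_left _ _))
      have h2 : h < δ := hh.2.trans_le ((min_le_left _ _).trans (min_le_right _ _))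
      have h3 : h < t := hh.2.trans_le (min_le_right _ _)
      obtain ⟨s, hs⟩ : ∃ s : ℝ≥0, (s : ℝ) = t - h := ⟨⟨t - h, by linarith⟩, rfl⟩
      have hst : s ≤ t := by
        rw [← NNReal.coe_le_coe, hs]
        exact sub_le_self _ hh.1
      have hv's := hv' s hst (by rw [hs]; linarith)
      refine ⟨s, hs, hst, hδe' _ ?_, hv's.1, hv's.2.trans ?_⟩
      · rw [hs, sub_sub_cancel_left, abs_neg, abs_of_nonneg hh.1]
        exact h2
      · rw [hs]
        module
    obtain ⟨η, hη, w, hw⟩ := (hM e' he' e he).exists_affine_on_ray (v := -v') (hmem t hte hte') (by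
      filter_upwards [Ioo_mem_nhdsGT hμ0] with h hh
      obtain ⟨s, -, -, hs, hs', hse⟩ := key h (Ioo_subset_Ico_self hh)
      rw [← hse]
      exact hmem s hs hs')
    refine ⟨min η μ, lt_min hη hμ0, -w, fun s hst hs => ?_⟩
    have hts : (0 : ℝ) ≤ t - s := sub_nonneg.2 hst
    obtain ⟨s', hs't, -, hs1, hs2, hs3⟩ := key (t - s) ⟨hts, hs.trans_le (min_le_right _ _)⟩
    have : s' = s := NNReal.coe_injective (by rw [hs't]; ring)
    subst this
    have h4 := hw (t - s') ⟨hts, hs.trans_le (min_le_left _ _)⟩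
    rw [← hs3, Function.comp_apply, Function.comp_apply,
      (e'.extend I).left_inv (by rwa [e'.extend_source]),
      (e'.extend I).left_inv (by rwa [e'.extend_source])] at h4
    rw [h4]
    module
  refine ⟨e, he, min (min ε δ) η, lt_min (lt_min hε hδ) hη, w, v, fun s hs =>
      ⟨?_, fun hst => ?_, fun hts => ?_⟩⟩
  · exact hδe' s (hs.trans_le ((min_le_left _ _).trans (min_le_right _ _)))
  · refine hw s hst ?_
    rw [abs_sub_comm] at hs
    exact (le_abs_self _).trans_lt (hs.trans_le (min_le_right _ _))
  · exact (hv s hts ((le_abs_self _).trans_lt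
      (hs.trans_le ((min_le_left _ _).trans (min_le_left _ _))))).2

end PiecewiseLinear

/-! ### Construction of the ray -/

section Ray

open Set Filter Topology

theorem exists_mem_Ico_natCast (t : ℝ≥0) : ∃ i : ℕ, (i : ℝ≥0) ≤ t ∧ t < i + 1 :=
  ⟨⌊t⌋₊, Nat.floor_le zero_le, Nat.lt_floor_add_one t⟩

theorem exists_mem_Ioc_natCast {t : ℝ≥0} (ht : 0 < t) : ∃ i : ℕ, (i : ℝ≥0) < t ∧ t ≤ i + 1 := by
  obtain ⟨i, hi⟩ := Nat.exists_eq_add_of_le' (Nat.ceil_pos.2 ht)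
  refine ⟨i, Nat.lt_ceil.1 (by omega), ?_⟩
  have := Nat.le_ceil t
  rw [hi] at this
  exact_mod_cast this

/-- An injective curve in an open cell that leaves every compact subset of the cell is a ray in it.
-/
theorem isRayIn_range {E M : Type*} [NormedAddCommGroup E] [NormedSpace ℝ E]
    [FiniteDimensional ℝ E] [TopologicalSpace M] [T2Space M] {j : E → M} (hj : IsOpenEmbedding j)
        {r : ℝ≥0 → M}
    (hc : Continuous r) (hi : Function.Injective r) (hr : ∀ t, r t ∈ range j)
    (hesc : ∀ K, IsCompact K → K ⊆ range j → ∃ T, ∀ t, T ≤ t → r t ∉ K) :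
    IsRayIn r (range j) := by
  have : WeaklyLocallyCompactSpace (range j) :=
    hj.isEmbedding.toHomeomorph.symm.isClosedEmbedding.weaklyLocallyCompactSpace
  refine ⟨hr, ?_⟩
  have hc' : Continuous (codRestrict r (range j) hr) := hc.subtype_mk _
  have hp : IsProperMap (codRestrict r (range j) hr) := by
    rw [isProperMap_iff_isCompact_preimage]
    refine ⟨hc', fun K hK => ?_⟩
    obtain ⟨T, hT⟩ := hesc (Subtype.val '' K) (hK.image continuous_subtype_val) (by
      rintro _ ⟨x, -, rfl⟩
      exact x.2)
    refine (isCompact_Icc (a := 0) (b := T)).of_isClosed_subset (hK.isClosed.preimage hc') fun t ht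
        =>
      ⟨zero_le, le_of_not_ge fun h => hT t h ⟨_, ht, rfl⟩⟩
  have hi' : Function.Injective (codRestrict r (range j) hr) := (injective_codRestrict hr).2 hi
  exact ⟨(Topology.IsClosedEmbedding.of_continuous_injective_isClosedMap hc' hi'
    hp.isClosedMap).isEmbedding, hp⟩

variable {E H M : Type*} [NormedAddCommGroup E] [NormedSpace ℝ E] [Nontrivial E]
  [TopologicalSpace H] {I : ModelWithCorners ℝ E H} [TopologicalSpace M] [T2Space M]
  [ChartedSpace H M]

/-- A chain of points that escapes along open sets `V k` can be replaced by an injective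
curve, which is piecewise linear if the manifold is. -/
theorem exists_injective_curve_of_escaping_chain {V : ℕ → Set M} {y : ℕ → M}
    (hVo : ∀ k, IsOpen (V k)) (hVa : Antitone V) (hy : ∀ k, JoinedIn (V k) (y k) (y (k + 1)))
    (hVK : ∀ K, IsCompact K → K ⊆ V 0 → ∃ k, Disjoint K (V k))
    (hint : ∀ x ∈ V 0, ∃ e ∈ atlas H M, x ∈ e.source ∧ (e.extend I).target ∈ 𝓝 (e.extend I x)) :
    ∃ r : ℝ≥0 → M, Continuous r ∧ Function.Injective r ∧ (∀ t, r t ∈ V 0) ∧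
      (∀ k, ∃ T, ∀ t, T ≤ t → r t ∈ V k) ∧ (IsPLManifold I M → IsPLCurve I r) := by
  have hV0 : ∀ k, V k ⊆ V 0 := fun k => hVa (Nat.zero_le k)
  obtain ⟨z, κ, hz, hκ⟩ := exists_infinite_chain fun k =>
    (hy k).transGen_segmentJoined (I := I) (hVo k) fun x hx => hint x (hV0 k hx)
  choose σ hσ hσ0 hσ1 hσV using hz
  have hLV : ∀ i, σ i '' Icc 0 1 ⊆ V (κ i) := by
    rintro i _ ⟨s, hs, rfl⟩
    exact hσV i s hs
  have hLc : ∀ i, IsCompact (σ i '' Icc 0 1) := fun i => isCompact_Icc.image_of_continuousOn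
      (hσ i).1
  obtain ⟨J, a, b, hJ, hab⟩ := exists_loop_erasure (fun i => (hσ i).1)
    (fun i => (hσ1 i).trans (hσ0 (i + 1)).symm) (fun i => by
      obtain ⟨k, hk⟩ := hVK _ (hLc i) ((hLV i).trans (hV0 _))
      obtain ⟨N, hN⟩ := eventually_atTop.1 (hκ.eventually_ge_atTop k)
      exact ⟨N, fun m hm => hk.mono_right ((hLV m).trans (hVa (hN m hm)))⟩)
  choose ha0 hlt hb1 hmatch hdis₁ hdis₂ using hab
  -- the pieces left by loop erasure, reparametrized by `[0, 1]`
  set τ : ℕ → ℝ → M := fun i u => σ (J i) (a i + u * (b i - a i)) with hτ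
  have hparam : ∀ i, ∀ u ∈ Icc (0 : ℝ) 1, a i + u * (b i - a i) ∈ Icc (a i) (b i) := by
    intro i u hu
    have := sub_pos.2 (hlt i)
    exact ⟨by nlinarith [hu.1], by nlinarith [hu.2]⟩
  have hsub : ∀ i, Icc (a i) (b i) ⊆ Icc 0 1 := fun i => Icc_subset_Icc (ha0 i) (hb1 i)
  have hτmem : ∀ i, ∀ u ∈ Icc (0 : ℝ) 1, τ i u ∈ σ (J i) '' Icc 0 1 := fun i u hu =>
    ⟨_, hsub i (hparam i u hu), rfl⟩
  have hτm : ∀ i, τ i 1 = τ (i + 1) 0 := by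
    intro i
    simp only [hτ, one_mul, zero_mul, add_zero, add_sub_cancel]
    exact hmatch i
  have hτc : ∀ i, ContinuousOn (τ i) (Icc 0 1) := fun i =>
    (hσ (J i)).1.comp (by fun_prop) fun u hu => hsub i (hparam i u hu)
  have hτi : ∀ i, InjOn (τ i) (Icc 0 1) := by
    intro i u hu w hw huw
    have := (hσ (J i)).injOn (hsub i (hparam i u hu)) (hsub i (hparam i w hw)) huw
    exact mul_right_cancel₀ (sub_pos.2 (hlt i)).ne' (add_left_cancel this)
  have hτne : ∀ i k, i < k → ∀ u ∈ Ico (0 : ℝ) 1, ∀ w ∈ Icc (0 : ℝ) 1, τ i u ≠ τ k w := by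
    intro i k hik u hu w hw huw
    have hmem : τ i u ∈ σ (J k) '' Icc 0 1 := huw ▸ hτmem k w hw
    have hpu := hparam i u (Ico_subset_Icc_self hu)
    rcases (Nat.succ_le_of_lt hik).lt_or_eq with h | rfl
    · exact hdis₂ i _ hpu _ (hJ h) hmem
    · refine hdis₁ i (a i + u * (b i - a i)) ⟨hpu.1, ?_⟩ hmem
      nlinarith [hu.2, sub_pos.2 (hlt i)]
  have hτV : ∀ i, ∀ u ∈ Icc (0 : ℝ) 1, τ i u ∈ V (κ (J i)) := fun i u hu => hLV _ (hτmem i u hu)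
  have hrange : ∀ t : ℝ≥0, ∀ i : ℕ, (i : ℝ≥0) ≤ t → t ≤ i + 1 → (t : ℝ) - i ∈ Icc (0 : ℝ) 1 := by
    intro t i h0 h1
    have h0 : (i : ℝ) ≤ t := by exact_mod_cast h0
    have h1 : (t : ℝ) ≤ i + 1 := by exact_mod_cast h1
    exact ⟨by linarith, by linarith⟩
  have hcont := continuous_concat hτm hτc
  -- each piece is affine in a chart
  have haff : ∀ i : ℕ, ∃ e ∈ atlas H M, ∃ v : E, ∀ t s : ℝ≥0, (i : ℝ≥0) ≤ t → t ≤ i + 1 →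
      (i : ℝ≥0) ≤ s → s ≤ i + 1 → concat τ s ∈ e.source ∧
        e.extend I (concat τ s) = e.extend I (concat τ t) + ((s : ℝ) - t) • v := by
    intro i
    obtain ⟨-, e, he, v, -, hv⟩ := hσ (J i)
    refine ⟨e, he, (b i - a i) • v, fun t s ht0 ht1 hs0 hs1 => ?_⟩
    rw [concat_apply hτm ht0 ht1, concat_apply hτm hs0 hs1]
    have h1 := hv _ (hsub i (hparam i _ (hrange t i ht0 ht1)))
    have h2 := hv _ (hsub i (hparam i _ (hrange s i hs0 hs1)))
    refine ⟨h2.1, ?_⟩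
    simp only [hτ]
    rw [h1.2, h2.2]
    module
  refine ⟨concat τ, hcont, concat_injective hτi hτne, fun t => ?_, fun k => ?_, fun hM =>
    hM.isPLCurve hcont (fun t => ?_) (fun t => ?_)⟩
  · obtain ⟨i, h0, h1⟩ := exists_mem_Ico_natCast t
    rw [concat_apply hτm h0 h1.le]
    exact hV0 _ (hτV i _ (hrange t i h0 h1.le))
  · obtain ⟨N, hN⟩ := eventually_atTop.1 ((hκ.comp hJ.tendsto_atTop).eventually_ge_atTop k)
    refine ⟨N, fun t ht => ?_⟩
    obtain ⟨i, h0, h1⟩ := exists_mem_Ico_natCast t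
    have hNi : N ≤ i := by
      have : (N : ℝ≥0) < i + 1 := ht.trans_lt h1
      exact Nat.lt_succ_iff.1 (by exact_mod_cast this)
    rw [concat_apply hτm h0 h1.le]
    exact hVa (hN i hNi) (hτV i _ (hrange t i h0 h1.le))
  · obtain ⟨i, h0, h1⟩ := exists_mem_Ico_natCast t
    obtain ⟨e, he, v, hv⟩ := haff i
    have h1' : (t : ℝ) < i + 1 := by exact_mod_cast h1
    refine ⟨e, he, i + 1 - t, by linarith, v, fun s hts hs => hv t s h0 h1.le (h0.trans hts) ?_⟩
    have : (s : ℝ) ≤ i + 1 := by linarith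
    exact_mod_cast this
  · rcases eq_or_lt_of_le (zero_le : 0 ≤ t) with rfl | ht
    · obtain ⟨e, he, v, hv⟩ := haff 0
      refine ⟨e, he, 1, one_pos, v, fun s hs _ => ?_⟩
      have : s = 0 := le_antisymm hs zero_le
      subst this
      exact hv 0 0 (by simp) (by simp) (by simp) (by simp)
    · obtain ⟨i, h0, h1⟩ := exists_mem_Ioc_natCast ht
      obtain ⟨e, he, v, hv⟩ := haff i
      have h0' : (i : ℝ) < t := by exact_mod_cast h0
      refine ⟨e, he, t - i, by linarith, v, fun s hst hs => hv t s h0.le h1 ?_ (hst.trans h1)⟩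
      have : (i : ℝ) ≤ s := by linarith
      exact_mod_cast this

/-- The common core of both parts: open cells `A`, `B` whose intersection is an open cell `C`, in a
space with charts that are interior at the points of `C`. -/
theorem exists_ray_in_inter [FiniteDimensional ℝ E] (hE : 1 < Module.rank ℝ E) {jA jB j : E → M}
    (hA : IsOpenEmbedding jA) (hB : IsOpenEmbedding jB) (hj : IsOpenEmbedding j)
    (hABC : range jA ∩ range jB = range j) (h1 : ¬ range jA ⊂ range jB)
    (h2 : ¬ range jB ⊂ range jA)
    (hint : ∀ x ∈ range j, ∃ e ∈ atlas H M, x ∈ e.source ∧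
      (e.extend I).target ∈ 𝓝 (e.extend I x)) :
    ∃ r : ℝ≥0 → M, IsRayIn r (range j) ∧ IsRayIn r (range jA) ∧ IsRayIn r (range jB) ∧
      (IsPLManifold I M → IsPLCurve I r) := by
  obtain ⟨V, y, hVo, hVj, hVa, hy, hVK⟩ := exists_escaping_chain hE hA hB hj hABC h1 h2
  have hjA : range j ⊆ range jA := hABC ▸ inter_subset_left
  have hjB : range j ⊆ range jB := hABC ▸ inter_subset_right
  obtain ⟨r, hc, hi, hr, hesc, hPL⟩ := exists_injective_curve_of_escaping_chain (I := I) hVo hVa hy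
    (fun K hK hKV => hVK K hK (Or.inl (hKV.trans ((hVj 0).trans hjA))))
    (fun x hx => hint x (hVj 0 hx))
  have hrj : ∀ t, r t ∈ range j := fun t => hVj 0 (hr t)
  have hK : ∀ K, IsCompact K → K ⊆ range jA ∨ K ⊆ range jB → ∃ T, ∀ t, T ≤ t → r t ∉ K := by
    intro K hK hKAB
    obtain ⟨k, hk⟩ := hVK K hK hKAB
    obtain ⟨T, hT⟩ := hesc k
    exact ⟨T, fun t ht h => Set.disjoint_left.1 hk h (hT t ht)⟩
  exact ⟨r, isRayIn_range hj hc hi hrj fun K h h' => hK K h (Or.inl (h'.trans hjA)),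
    isRayIn_range hA hc hi (fun t => hjA (hrj t)) fun K h h' => hK K h (Or.inl h'),
    isRayIn_range hB hc hi (fun t => hjB (hrj t)) fun K h h' => hK K h (Or.inr h'), hPL⟩

end Ray

/-! ### Cells in manifolds -/

section Cells

open Set Filter Topology Metric

/-- By invariance of domain, a copy of the model vector space inside a manifold (possibly with
boundary) is open and consists of points at which the charts are interior. -/
theorem isOpenEmbedding_of_isEmbedding {E H M : Type*} [NormedAddCommGroup E]
    [InnerProductSpace ℝ E] [FiniteDimensional ℝ E] [Nontrivial E] [TopologicalSpace H]
    (I : ModelWithCorners ℝ E H) [TopologicalSpace M] [ChartedSpace H M] {j : E → M}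
    (hj : IsEmbedding j) : IsOpenEmbedding j ∧ ∀ x ∈ range j, ∃ e ∈ atlas H M, x ∈ e.source ∧
      (e.extend I).target ∈ 𝓝 (e.extend I x) := by
  have key : ∀ z, ∃ e ∈ atlas H M, j z ∈ e.source ∧ (e.extend I).target ∈ 𝓝 (e.extend I (j z)) ∧
      range j ∈ 𝓝 (j z) := by
    intro z
    set e := chartAt H (j z)
    have hz : j z ∈ e.source := mem_chart_source H (j z)
    set U : Set E := j ⁻¹' e.source
    have hsrc : ∀ {p}, p ∈ e.source → p ∈ (e.extend I).source := fun hp => by rwa [e.extend_source]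
    have hopen : IsOpen ((fun w => e.extend I (j w)) '' U) := by
      refine isOpen_image_of_continuousOn_injOn (e.open_source.preimage hj.continuous) ?_ ?_
      · exact (e.continuousOn_extend (I := I)).comp hj.continuous.continuousOn fun w hw => hsrc hw
      · intro v hv w hw hvw
        exact hj.injective ((e.extend I).injOn (hsrc hv) (hsrc hw) hvw)
    have hmem : (fun w => e.extend I (j w)) '' U ∈ 𝓝 (e.extend I (j z)) :=
      hopen.mem_nhds ⟨z, hz, rfl⟩
    refine ⟨e, chart_mem_atlas H (j z), hz, Filter.mem_of_superset hmem ?_, ?_⟩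
    · rintro _ ⟨w, hw, rfl⟩
      exact (e.extend I).map_source (hsrc hw)
    · filter_upwards [e.open_source.mem_nhds hz,
        (e.continuousAt_extend (I := I) hz).preimage_mem_nhds hmem] with p hp hpU
      obtain ⟨w, hw, hwp⟩ := hpU
      exact ⟨w, (e.extend I).injOn (hsrc hw) (hsrc hp) hwp⟩
  refine ⟨⟨hj, isOpen_iff_mem_nhds.2 ?_⟩, ?_⟩
  · rintro _ ⟨z, rfl⟩
    obtain ⟨-, -, -, -, h⟩ := key z
    exact h
  · rintro _ ⟨z, rfl⟩
    obtain ⟨e, he, h1, h2, -⟩ := key z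
    exact ⟨e, he, h1, h2⟩

/-- A parametrization by `X` of a subspace homeomorphic to `X`. -/
theorem Homeomorph.exists_isEmbedding {X M : Type*} [TopologicalSpace X] [TopologicalSpace M]
    {A : Set M} (h : A ≃ₜ X) : ∃ j : X → M, IsEmbedding j ∧ range j = A := by
  refine ⟨Subtype.val ∘ h.symm, IsEmbedding.subtypeVal.comp h.symm.isEmbedding, ?_⟩
  rw [range_comp, h.symm.surjective.range_eq, image_univ, Subtype.range_coe]

variable {n : ℕ} {M : Type*} [TopologicalSpace M]

/-- By invariance of domain, an injective image of `ℝⁿ` in a closed cell lies in the interior of the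
cell. -/
theorem exists_norm_lt_one_of_mem_range [NeZero n] {A : Set M}
    (h : A ≃ₜ closedBall (0 : EuclideanSpace ℝ (Fin n)) 1) {k : EuclideanSpace ℝ (Fin n) → M}
    (hk : Continuous k) (hi : Function.Injective k) (hkA : range k ⊆ A) {x : M} (hx : x ∈ range k) :
    ‖(h ⟨x, hkA hx⟩ : EuclideanSpace ℝ (Fin n))‖ < 1 := by
  set ψ : EuclideanSpace ℝ (Fin n) → EuclideanSpace ℝ (Fin n) := fun w => h ⟨k w, hkA ⟨w, rfl⟩⟩
  have hψ : IsOpen (range ψ) := by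
    rw [← image_univ]
    refine isOpen_image_of_continuousOn_injOn isOpen_univ ?_ ?_
    · exact (continuous_subtype_val.comp (h.continuous.comp (hk.subtype_mk _))).continuousOn
    · intro v _ w _ hvw
      have := h.injective (Subtype.ext hvw)
      exact hi (congrArg Subtype.val this)
  have hsub : range ψ ⊆ ball 0 1 := by
    rw [← interior_closedBall _ one_ne_zero]
    refine interior_maximal ?_ hψ
    rintro _ ⟨w, rfl⟩
    exact (h _).2
  obtain ⟨w, rfl⟩ := hx
  exact mem_ball_zero_iff.1 (hsub ⟨w, rfl⟩)

/-- The interior of a closed cell is the image of the open ball; in particular it is parametrized by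
`ℝⁿ`. -/
theorem exists_isEmbedding_range_eq_manifoldInterior [NeZero n] {A : Set M}
    (h : A ≃ₜ closedBall (0 : EuclideanSpace ℝ (Fin n)) 1) :
    ∃ j : EuclideanSpace ℝ (Fin n) → M, IsEmbedding j ∧ range j = manifoldInterior n A ∧
      manifoldInterior n A ⊆ A ∧ A ⊆ closure (manifoldInterior n A) ∧
      ∀ k : EuclideanSpace ℝ (Fin n) → M, Continuous k → Function.Injective k → range k ⊆ A →
        range k ⊆ manifoldInterior n A := by
  set D : Set (closedBall (0 : EuclideanSpace ℝ (Fin n)) 1) :=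
      {w | ‖(w : EuclideanSpace ℝ (Fin n))‖ < 1}
  have hDo : IsOpen D := isOpen_lt (by fun_prop) continuous_const
  set j : EuclideanSpace ℝ (Fin n) → M := fun z => h.symm (Set.inclusion ball_subset_closedBall
    (Homeomorph.unitBall z)) with hjdef
  have hj : IsEmbedding j := IsEmbedding.subtypeVal.comp (h.symm.isEmbedding.comp
    ((IsEmbedding.inclusion ball_subset_closedBall).comp Homeomorph.unitBall.isEmbedding))
  have hjA : range j ⊆ A := by
    rintro _ ⟨z, rfl⟩
    exact (h.symm _).2
  have hjmem : ∀ x : A, h x ∈ D → (x : M) ∈ range j := by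
    intro x hx
    refine ⟨Homeomorph.unitBall.symm ⟨h x, mem_ball_zero_iff.2 hx⟩, ?_⟩
    simp only [hjdef, Homeomorph.apply_symm_apply]
    have : Set.inclusion ball_subset_closedBall ⟨(h x : EuclideanSpace ℝ (Fin n)),
        mem_ball_zero_iff.2 hx⟩ = h x := Subtype.ext rfl
    rw [this, h.symm_apply_apply]
  have hjD : ∀ z, ∃ x : A, (x : M) = j z ∧ h x ∈ D := by
    intro z
    refine ⟨h.symm (Set.inclusion ball_subset_closedBall (Homeomorph.unitBall z)), rfl, ?_⟩
    rw [h.apply_symm_apply]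
    exact mem_ball_zero_iff.1 (Homeomorph.unitBall z).2
  have hk : ∀ k : EuclideanSpace ℝ (Fin n) → M, Continuous k → Function.Injective k → range k ⊆ A →
      range k ⊆ range j := by
    intro k hkc hki hkA x hx
    exact hjmem ⟨x, hkA hx⟩ (exists_norm_lt_one_of_mem_range h hkc hki hkA hx)
  have hrange : range j = manifoldInterior n A := by
    apply Subset.antisymm
    · obtain ⟨O, hO, hOD⟩ := isOpen_induced_iff.1 (hDo.preimage h.continuous)
      have hAO : A ∩ O = range j := by
        ext x
        constructor
        · rintro ⟨hxA, hxO⟩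
          have : (⟨x, hxA⟩ : A) ∈ h ⁻¹' D := hOD ▸ hxO
          exact hjmem ⟨x, hxA⟩ this
        · rintro ⟨z, rfl⟩
          refine ⟨hjA ⟨z, rfl⟩, ?_⟩
          obtain ⟨x, hxz, hx⟩ := hjD z
          have : x ∈ Subtype.val ⁻¹' O := hOD.symm ▸ hx
          rw [← hxz]
          exact this
      rintro x hx
      exact ⟨O, hO, hAO ▸ hx, ⟨(Homeomorph.setCongr hAO).trans hj.toHomeomorph.symm⟩⟩
    · rintro x ⟨O, -, hxO, ⟨g⟩⟩
      obtain ⟨k, hke, hkr⟩ := g.exists_isEmbedding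
      exact hk k hke.continuous hke.injective (hkr ▸ inter_subset_left) (hkr ▸ hxO)
  refine ⟨j, hj, hrange, hrange ▸ hjA, ?_, hrange ▸ hk⟩
  intro x hx
  have hdense : h ⟨x, hx⟩ ∈ closure D := by
    rw [closure_subtype]
    have hDball : Subtype.val '' D = ball (0 : EuclideanSpace ℝ (Fin n)) 1 := by
      ext w
      rw [mem_ball_zero_iff]
      exact ⟨fun ⟨w', hw', h⟩ => h ▸ hw', fun hw => ⟨⟨w, mem_closedBall_zero_iff.2 hw.le⟩, hw, rfl⟩⟩
    rw [hDball, closure_ball _ one_ne_zero]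
    exact (h ⟨x, hx⟩).2
  have hc : Continuous fun w => (h.symm w : M) := continuous_subtype_val.comp h.symm.continuous
  have := image_closure_subset_closure_image hc ⟨_, hdense, rfl⟩
  simp only [h.symm_apply_apply] at this
  refine closure_mono ?_ this
  rintro _ ⟨w, hw, rfl⟩
  rw [← hrange]
  exact hjmem (h.symm w) (by rwa [h.apply_symm_apply])

end Cells

theorem lemma5p4p3 (n : ℕ) [NeZero n] (hn : 2 ≤ n) :
    (∀ (M : Type u) [TopologicalSpace M] [T2Space M] [ChartedSpace (EuclideanSpace ℝ (Fin n)) M]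
        [ContractibleSpace M] (A B C : Set M),
        IsOpenSplitting n A B C → ¬ A ⊂ B → ¬ B ⊂ A →
        ∃ r : ℝ≥0 → M, IsRayIn r C ∧ IsRayIn r A ∧ IsRayIn r B ∧
          (IsPLManifold (𝓡 n) M → IsPLCurve (𝓡 n) r)) ∧
    (∀ (M : Type u) [TopologicalSpace M] [T2Space M] [ChartedSpace (EuclideanHalfSpace n) M]
        [CompactSpace M] [ContractibleSpace M] (A B C : Set M),
        IsClosedSplitting n A B C → ¬ A ⊂ B → ¬ B ⊂ A →
        ∃ r : ℝ≥0 → M, IsRayIn r (manifoldInterior n C) ∧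
          IsRayIn r (manifoldInterior n A) ∧ IsRayIn r (manifoldInterior n B) ∧
          (IsPLManifold (𝓡∂ n) M → IsPLCurve (𝓡∂ n) r)) := by
  have hrank : 1 < Module.rank ℝ (EuclideanSpace ℝ (Fin n)) := by
    rw [← Module.finrank_eq_rank, finrank_euclideanSpace_fin]
    exact_mod_cast hn
  constructor
  · intro M _ _ _ _ A B C hS h1 h2
    obtain ⟨-, hABC, ⟨hA⟩, ⟨hB⟩, ⟨hC⟩⟩ := hS
    obtain ⟨jA, hjA, rfl⟩ := hA.exists_isEmbedding
    obtain ⟨jB, hjB, rfl⟩ := hB.exists_isEmbedding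
    obtain ⟨j, hj, rfl⟩ := hC.exists_isEmbedding
    obtain ⟨hjo, hint⟩ := isOpenEmbedding_of_isEmbedding (𝓡 n) hj
    exact exists_ray_in_inter hrank (isOpenEmbedding_of_isEmbedding (𝓡 n) hjA).1
      (isOpenEmbedding_of_isEmbedding (𝓡 n) hjB).1 hjo hABC h1 h2 hint
  · intro M _ _ _ _ _ A B C hS h1 h2
    obtain ⟨-, hABC, ⟨hA⟩, ⟨hB⟩, ⟨hC⟩⟩ := hS
    have hcompact : ∀ {S : Set M}, S ≃ₜ Metric.closedBall (0 : EuclideanSpace ℝ (Fin n)) 1 →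
        IsClosed S := fun h => by
      have := h.symm.compactSpace
      exact (isCompact_iff_compactSpace.2 this).isClosed
    have hAc := hcompact hA
    have hBc := hcompact hB
    obtain ⟨jA, hjA, hrA, hAs, hAd, hAk⟩ := exists_isEmbedding_range_eq_manifoldInterior hA
    obtain ⟨jB, hjB, hrB, hBs, hBd, hBk⟩ := exists_isEmbedding_range_eq_manifoldInterior hB
    obtain ⟨j, hj, hrC, hCs, -, hCk⟩ := exists_isEmbedding_range_eq_manifoldInterior hC
    obtain ⟨hjo, hint⟩ := isOpenEmbedding_of_isEmbedding (𝓡∂ n) hj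
    have hjAo := (isOpenEmbedding_of_isEmbedding (𝓡∂ n) hjA).1
    have hjBo := (isOpenEmbedding_of_isEmbedding (𝓡∂ n) hjB).1
    have hCAB : C ⊆ A ∧ C ⊆ B := hABC ▸ ⟨Set.inter_subset_left, Set.inter_subset_right⟩
    have hrange : Set.range jA ∩ Set.range jB = Set.range j := by
      apply Set.Subset.antisymm
      · rintro _ ⟨⟨z, rfl⟩, hzB⟩
        obtain ⟨ρ, hρ, hball⟩ := Metric.mem_nhds_iff.1
          ((hjBo.isOpen_range.preimage hjA.continuous).mem_nhds hzB)
        -- a small cell around `z`, parametrized by the whole of `ℝⁿ`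
        set β := OpenPartialHomeomorph.univBall z ρ with hβ
        have hβs : β.source = Set.univ := OpenPartialHomeomorph.univBall_source z ρ
        have hβm : ∀ w, β w ∈ Metric.ball z ρ := fun w => by
          rw [← OpenPartialHomeomorph.univBall_target z hρ]
          exact β.map_source (hβs ▸ Set.mem_univ w)
        rw [hrC]
        refine hCk (fun w => jA (β w)) ?_ ?_ ?_ ⟨0, ?_⟩
        · exact hjA.continuous.comp (OpenPartialHomeomorph.continuous_univBall z ρ)
        · exact hjA.injective.comp fun v w hvw =>
            β.injOn (hβs ▸ Set.mem_univ v) (hβs ▸ Set.mem_univ w) hvw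
        · rintro _ ⟨w, rfl⟩
          rw [← hABC]
          exact ⟨hAs (hrA ▸ ⟨β w, rfl⟩), hBs (hrB ▸ hball (hβm w))⟩
        · simp only [hβ, OpenPartialHomeomorph.univBall_apply_zero]
      · rw [hrA, hrB]
        have hjC : Set.range j ⊆ C := hrC ▸ hCs
        exact Set.subset_inter (hAk j hj.continuous hj.injective (hjC.trans hCAB.1))
          (hBk j hj.continuous hj.injective (hjC.trans hCAB.2))
    have hss : ∀ {S T : Set M}, IsClosed T → S ⊆ closure (manifoldInterior n S) →
        manifoldInterior n T ⊆ T → ¬ S ⊂ T → ¬ manifoldInterior n S ⊂ manifoldInterior n T := by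
      intro S T hT hSd hTs hST hlt
      have hsub : S ⊆ T := hSd.trans (closure_minimal (hlt.subset.trans hTs) hT)
      have : S = T := by
        by_contra hne
        exact hST (hsub.ssubset_of_ne hne)
      exact hlt.ne (congrArg _ this)
    have := exists_ray_in_inter hrank hjAo hjBo hjo hrange
        (hrA.symm ▸ hrB.symm ▸ hss hBc hAd hBs h1)
      (hrA.symm ▸ hrB.symm ▸ hss hAc hBd hAs h2) hint
    rwa [hrA, hrB, hrC] at this
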